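/- **PageRank.** Let $G$ be a directed graph (self-loops allowed) on $n\ge 1$ nodes and let $\alpha\in(0,1)$. Let $M$ be the $n\times n$ matrix with $M_{ij}=1/n$ if node $i$ has no children, and otherwise $M_{ij}=1/m$ or $0$ according to whether $j$ is or is not one of the $m$ children of $i$. The PageRank scores $P=(P(w))_w$ of $G$ are the unique solution of $P=\alpha PM+\frac{1-\alpha}{n}(1,\dots,1)$. **Natural queries.** A natural query on the node set $V$ is a (possibly randomized) query which, on every graph $G$ with node set $V$, always returns a (possibly empty) weakly connected subgraph of $G$, and which is either *global* (the law of its answer does not depend on the arcs of $G$) or *local* at a node $w$ (the law of its answer depends only on the arcs of $G$ entering or leaving $w$). **Algorithms.** A Monte Carlo ranking algorithm using only natural queries receives an ordered pair of input nodes. At every step, with its own randomness and depending on the input and on all earlier queries and answers, it either stops and names one node as the one with the higher score, or asks a natural query; a local query may be asked only at a known node, i.e. an input node or a node contained in an earlier answer. The algorithm may know the node set and hence $n$, i.e. it may be a different one for each $n$. For nodes $u,v$ of $G$ with $P(u)>P(v)$, its success probability on $(G,u,v)$ is the probability that it stops and names $u$, and its expected number of queries (possibly infinite) is computed likewise, when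 $u,v$ are given as input in uniformly random order. **Theorem.** Let $\alpha\in(0,1)$ and $\eta>0$. There are constants $C,c_1,c_2>0$ and a function $\kappa:(0,\infty)\to(0,\infty)$, depending only on $\alpha$ and $\eta$, such that the following holds. Let $f,\gamma$ be any real functions with $\frac1n\le f(n)\le 1$ and $\gamma(n)\ge 1$ for all $n\ge1$, and take any Monte Carlo ranking algorithm using only natural queries. Then for arbitrarily large $n$ there are a directed graph $G$ on the node set $\{0,\dots,n-1\}$ and two nodes $u,v$ of $G$ such that 1. every node of $G$ has outdegree at most $C\,\gamma(n)$; 2. $c_1 f(n)\le P(u)\le c_2 f(n)$ and $c_1 f(n)\le P(v)\le c_2 f(n)$; 3. $P(u)>(1+\eta)P(v)$; 4. for every $\delta>0$: if the algorithm has success probability at least $\frac12+\delta$ on $(G,u,v)$, then its expected number of queries on $(G,u,v)$ is at least $$\kappa(\delta)\cdot\min\!\left(\frac1{f(n)},\; n^{2/3},\; n^{1/2}\gamma(n)^{1/2}\right).$$ -/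

import Mathlib

noncomputable section

namespace PageRankLB

/-! ### PageRank -/

/-- The outdegree of `v`: the number of its children. -/
def outdegree {V : Type} (G : Digraph V) (v : V) : ℕ := {w | G.Adj v w}.ncard

open Classical in
/-- The matrix `M` of the random walk: a node without children moves to a uniformly random node,
any other node moves to a uniformly random child. -/
def walkMatrix {V : Type} [Fintype V] (G : Digraph V) : Matrix V V ℝ :=
  Matrix.of fun i j =>
    if outdegree G i = 0 then (Fintype.card V : ℝ)⁻¹
    else if G.Adj i j then (outdegree G i : ℝ)⁻¹ else 0

/-- `P` solves the PageRank equation `P = α P M + (1 - α) n⁻¹`. -/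
def IsPageRank {V : Type} [Fintype V] (α : ℝ) (G : Digraph V) (P : V → ℝ) : Prop :=
  P = α • Matrix.vecMul P (walkMatrix G) + fun _ => (1 - α) * (Fintype.card V : ℝ)⁻¹

open Classical in
/-- The vector of PageRank scores. For `0 < α < 1` it is the unique solution of the PageRank
equation, see `isPageRank_iff`. -/
def pageRank {V : Type} [Fintype V] (α : ℝ) (G : Digraph V) : V → ℝ :=
  Matrix.vecMul (fun _ => (1 - α) * (Fintype.card V : ℝ)⁻¹) (1 - α • walkMatrix G)⁻¹

theorem walkMatrix_nonneg {V : Type} [Fintype V] (G : Digraph V) (i j : V) :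
    0 ≤ walkMatrix G i j := by
  simp only [walkMatrix, Matrix.of_apply]
  split_ifs <;> positivity

theorem walkMatrix_row_sum {V : Type} [Fintype V] (G : Digraph V) (i : V) :
    ∑ j, walkMatrix G i j = 1 := by
  classical
  have : Nonempty V := ⟨i⟩
  simp only [walkMatrix, Matrix.of_apply]
  split_ifs with h
  · simp
  · rw [← Finset.sum_filter, Finset.sum_const, nsmul_eq_mul]
    have hc : (Finset.univ.filter fun j => G.Adj i j).card = outdegree G i := by
      rw [outdegree, ← Set.ncard_coe_finset]
      simp
    rw [hc]
    exact mul_inv_cancel₀ (by exact_mod_cast h)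

theorem isUnit_det {V : Type} [Fintype V] [DecidableEq V] {α : ℝ} (h0 : 0 < α) (h1 : α < 1)
    (G : Digraph V) : IsUnit (1 - α • walkMatrix G).det := by
  rw [isUnit_iff_ne_zero]
  apply det_ne_zero_of_sum_row_lt_diag
  intro k
  have hs := walkMatrix_row_sum G k
  rw [← Finset.add_sum_erase _ _ (Finset.mem_univ k)] at hs
  have hr : ∑ j ∈ Finset.univ.erase k, ‖(1 - α • walkMatrix G) k j‖
      = α * ∑ j ∈ Finset.univ.erase k, walkMatrix G k j := by
    rw [Finset.mul_sum]
    refine Finset.sum_congr rfl fun j hj => ?_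
    have hkj : k ≠ j := (Finset.ne_of_mem_erase hj).symm
    have := mul_nonneg h0.le (walkMatrix_nonneg G k j)
    simp [Matrix.sub_apply, Matrix.one_apply_ne hkj, abs_of_nonneg, h0.le,
      walkMatrix_nonneg G k j]
  rw [hr]
  have hd : (1 - α • walkMatrix G) k k = 1 - α * walkMatrix G k k := by simp
  rw [hd, Real.norm_eq_abs]
  refine lt_of_lt_of_le ?_ (le_abs_self _)
  nlinarith

/-- The PageRank vector is the unique solution of the PageRank equation. -/
theorem isPageRank_iff {V : Type} [Fintype V] {α : ℝ} (h0 : 0 < α) (h1 : α < 1)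
    (G : Digraph V) (P : V → ℝ) : IsPageRank α G P ↔ P = pageRank α G := by
  classical
  have hu := isUnit_det h0 h1 G
  have key : IsPageRank α G P ↔
      Matrix.vecMul P (1 - α • walkMatrix G) = fun _ => (1 - α) * (Fintype.card V : ℝ)⁻¹ := by
    rw [IsPageRank, Matrix.vecMul_sub, Matrix.vecMul_one, Matrix.vecMul_smul, sub_eq_iff_eq_add']
  rw [key, pageRank]
  constructor
  · intro h
    rw [← h, Matrix.vecMul_vecMul, Matrix.mul_nonsing_inv _ hu, Matrix.vecMul_one]
  · intro h
    rw [h, Matrix.vecMul_vecMul, Matrix.nonsing_inv_mul _ hu, Matrix.vecMul_one]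

/-! ### Natural exploration queries -/

/-- What a query may return: a set of nodes and a set of arcs between them. -/
@[ext]
structure Fragment (V : Type) where
  verts : Set V
  Adj : V → V → Prop
  left_mem : ∀ x y, Adj x y → x ∈ verts
  right_mem : ∀ x y, Adj x y → y ∈ verts

/-- The fragment is a subgraph of `G` (all elements of `V` are nodes of `G`). -/
def Fragment.IsSubgraphOf {V : Type} (S : Fragment V) (G : Digraph V) : Prop :=
  ∀ x y, S.Adj x y → G.Adj x y

/-- The fragment is (weakly) connected; it may be empty. -/
def Fragment.IsConnected {V : Type} (S : Fragment V) : Prop :=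
  ∀ x ∈ S.verts, ∀ y ∈ S.verts,
    Relation.ReflTransGen (fun a b => S.Adj a b ∨ S.Adj b a) x y

/-- A (possibly randomized) query, with all its inputs fixed: on each graph with node set `V`
it returns a random fragment. -/
def Query (V : Type) : Type := Digraph V → PMF (Fragment V)

/-- The answer depends on the nodes of the graph only, not on its arcs. -/
def Query.IsGlobal {V : Type} (Q : Query V) : Prop := ∀ G G' : Digraph V, Q G = Q G'

/-- The answer depends only on the arcs insisting on the node `w`, outgoing or incoming. -/
def Query.IsLocalAt {V : Type} (Q : Query V) (w : V) : Prop :=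
  ∀ G G' : Digraph V, (∀ x, G.Adj w x ↔ G'.Adj w x) → (∀ x, G.Adj x w ↔ G'.Adj x w) → Q G = Q G'

/-- `Q` is a natural query that may be asked when the nodes in `known` are known: it always
returns a (possibly empty) connected subgraph of the graph, and it is either global, or local at
a node that is already known. -/
def Query.IsNatural {V : Type} (known : Set V) (Q : Query V) : Prop :=
  (∀ G : Digraph V, ∀ S ∈ (Q G).support, S.IsSubgraphOf G ∧ S.IsConnected) ∧
    (Q.IsGlobal ∨ ∃ w ∈ known, Q.IsLocalAt w)

/-! ### Monte Carlo ranking algorithms -/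

/-- The queries asked so far with their answers, in chronological order. -/
abbrev History (V : Type) : Type := List (Query V × Fragment V)

/-- The nodes known to the algorithm: the two input nodes and all nodes in earlier answers. -/
def known {V : Type} (input : V × V) (h : History V) : Set V :=
  {x | x = input.1 ∨ x = input.2 ∨ ∃ e ∈ h, x ∈ e.2.verts}

/-- A Monte Carlo algorithm that ranks two nodes with natural queries only. Given the ordered pair
of input nodes and everything asked and answered so far, it draws its next action at random:
either it stops and names the node that it believes to have the higher score, or it asks a
natural query. -/
structure RankingAlgorithm (V : Type) where
  next : (input : V × V) → (h : History V) →
    PMF (V ⊕ {Q : Query V // Q.IsNatural (known input h)})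

/-- The situation of a run: still running, or stopped with an answer. -/
inductive Config (V : Type) : Type
  | running (h : History V)
  | stopped (answer : V)

/-- One action of the algorithm on the graph `G`. -/
def RankingAlgorithm.step {V : Type} (A : RankingAlgorithm V) (G : Digraph V) (input : V × V) :
    Config V → PMF (Config V)
  | .stopped a => PMF.pure (.stopped a)
  | .running h => (A.next input h).bind fun
      | .inl a => PMF.pure (.stopped a)
      | .inr Q => (Q.1 G).map fun S => .running (h ++ [(Q.1, S)])

/-- The law of the situation after `t` actions. It is `running` exactly if `t` queries have been
asked so far without stopping. -/
def RankingAlgorithm.run {V : Type} (A : RankingAlgorithm V) (G : Digraph V) (input : V × V) :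
    ℕ → PMF (Config V)
  | 0 => PMF.pure (.running [])
  | t + 1 => (A.run G input t).bind (A.step G input)

/-- The probability that the algorithm stops with answer `a`. -/
def RankingAlgorithm.probAnswer {V : Type} (A : RankingAlgorithm V) (G : Digraph V)
    (input : V × V) (a : V) : ENNReal :=
  ⨆ t : ℕ, A.run G input t (.stopped a)

/-- The expected number of queries, as the sum over `t` of the probability that a `(t+1)`-st query
is asked. It is infinite if the algorithm runs forever with positive probability. -/
def RankingAlgorithm.expectedQueries {V : Type} (A : RankingAlgorithm V) (G : Digraph V)
    (input : V × V) : ENNReal :=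
  ∑' t : ℕ, (A.run G input (t + 1)).toOuterMeasure (Set.range Config.running)

/-- The probability of the answer `u` when the input nodes `u`, `v` are presented in uniformly
random order. -/
def RankingAlgorithm.successProb {V : Type} (A : RankingAlgorithm V) (G : Digraph V)
    (u v : V) : ENNReal :=
  (A.probAnswer G (u, v) u + A.probAnswer G (v, u) u) / 2

/-- The expected number of queries when the input nodes `u`, `v` are presented in uniformly
random order. -/
def RankingAlgorithm.meanQueries {V : Type} (A : RankingAlgorithm V) (G : Digraph V)
    (u v : V) : ENNReal :=
  (A.expectedQueries G (u, v) + A.expectedQueries G (v, u)) / 2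

end PageRankLB

end

/-! Each of the two ranked nodes ends a path whose start has `k` weak parents of outdegree `d + 1`.
In the instance `(t, p, q)` the `m` nodes of block `q` are redirected to parent `p` on side `t`, and
this parent drops its dummy children. This lifts node `t` above the other by a constant factor. In
the base graph `gadget none` nothing is redirected and the two sides look alike. A local query tells
an instance from the base graph only if it is asked in the selected cell or block, so each query
separates the base graph from at most `max B (2 * k)` of the `2 * k * B` instances
(`ncard_distinguishing_le`). Comparing runs step by step (`sum_probAnswer_le`) shows that with far
fewer than `min (2 * k) B` queries the answer is, on average, that of the base graph, hence a blind
guess of `t`. Since the resulting bound is linear in `δ`, averaging yields a single instance that is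
hard for all `δ` at once (`exists_hard_instance`).

For the sizes, let `L` be the minimum in the theorem. Blocks of size `m ~ n / L` leave room for
about `L` of them. The two scores must be comparable, so `k / (d + 1)` has order `m`; then `k` is at
least of order `L` once `d + 1 ~ max 1 (L ^ 2 / n)`, which `L ^ 2 ≤ n * γ` permits. The `k * (d +
1)` cell nodes fit because `L ^ 3 ≤ n ^ 2` (`exists_sizes`). The path scales the incoming score,
about `1 / L`, down to order `f`, which is possible because `L * f ≤ 1` (`exists_dilution`,
`score_bounds`). -/

open scoped ENNReal

/-! ### Expectations of extended nonnegative functions under discrete laws. -/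

namespace PMF

/-- The expectation of a nonnegative function. -/
noncomputable def expect {X : Type*} (μ : PMF X) (g : X → ℝ≥0∞) : ℝ≥0∞ := ∑' x, μ x * g x

variable {X Y : Type*}

theorem expect_bind (μ : PMF X) (f : X → PMF Y) (g : Y → ℝ≥0∞) :
    (μ.bind f).expect g = μ.expect fun x => (f x).expect g := by
  simp only [expect, PMF.bind_apply, ← ENNReal.tsum_mul_right, ← ENNReal.tsum_mul_left]
  rw [ENNReal.tsum_comm]
  simp only [mul_assoc]

theorem expect_pure (x : X) (g : X → ℝ≥0∞) : (PMF.pure x).expect g = g x := by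
  classical
  rw [expect, tsum_eq_single x]
  · simp
  · intro y hy
    simp [PMF.pure_apply, hy]

theorem expect_map (μ : PMF X) (f : X → Y) (g : Y → ℝ≥0∞) :
    (μ.map f).expect g = μ.expect fun x => g (f x) := by
  rw [PMF.map, expect_bind]
  simp only [Function.comp_apply, expect_pure]

theorem expect_mono (μ : PMF X) {g g' : X → ℝ≥0∞} (h : ∀ x, g x ≤ g' x) :
    μ.expect g ≤ μ.expect g' :=
  ENNReal.tsum_le_tsum fun x => by gcongr; exact h x

theorem expect_add (μ : PMF X) (g g' : X → ℝ≥0∞) :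
    μ.expect (fun x => g x + g' x) = μ.expect g + μ.expect g' := by
  simp only [expect, mul_add, ENNReal.tsum_add]

theorem expect_const (μ : PMF X) (c : ℝ≥0∞) : μ.expect (fun _ => c) = c := by
  rw [expect, ENNReal.tsum_mul_right, μ.tsum_coe, one_mul]

theorem expect_const_mul (μ : PMF X) (c : ℝ≥0∞) (g : X → ℝ≥0∞) :
    μ.expect (fun x => c * g x) = c * μ.expect g := by
  rw [expect, expect, ← ENNReal.tsum_mul_left]
  simp only [mul_left_comm]

theorem expect_finset_sum {ι : Type*} (μ : PMF X) (s : Finset ι) (g : ι → X → ℝ≥0∞) :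
    μ.expect (fun x => ∑ i ∈ s, g i x) = ∑ i ∈ s, μ.expect (g i) := by
  simp only [expect, Finset.mul_sum]
  exact Summable.tsum_finsetSum fun _ _ => ENNReal.summable

theorem expect_le_one (μ : PMF X) {g : X → ℝ≥0∞} (h : ∀ x, g x ≤ 1) : μ.expect g ≤ 1 :=
  (μ.expect_mono h).trans_eq (μ.expect_const 1)

end PMF

/-! ### Comparing the runs of an algorithm on two graphs. -/

namespace PageRankLB

variable {V : Type}

/-- The indicator function of the running configurations. -/
def Config.isRunning : Config V → ℝ≥0∞
  | .running _ => 1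
  | .stopped _ => 0

open Classical in
/-- The indicator function of the configurations stopped with answer `a`. -/
noncomputable def Config.isStopped (a : V) : Config V → ℝ≥0∞
  | .running _ => 0
  | .stopped b => if b = a then 1 else 0

theorem Config.isRunning_le_one (c : Config V) : c.isRunning ≤ 1 := by
  cases c <;> simp [isRunning]

theorem Config.isStopped_le_one (a : V) (c : Config V) : c.isStopped a ≤ 1 := by
  cases c with
  | running h => simp [isStopped]
  | stopped b => simp only [isStopped]; split_ifs <;> simp

theorem expect_isStopped (μ : PMF (Config V)) (a : V) :
    μ.expect (Config.isStopped a) = μ (.stopped a) := by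
  rw [PMF.expect, tsum_eq_single (.stopped a)]
  · simp [Config.isStopped]
  · intro c hc
    cases c with
    | running h => simp [Config.isStopped]
    | stopped b =>
      have : b ≠ a := fun h => hc (by rw [h])
      simp [Config.isStopped, this]

theorem expect_isRunning (μ : PMF (Config V)) :
    μ.expect Config.isRunning = μ.toOuterMeasure (Set.range Config.running) := by
  classical
  rw [PMF.expect, PMF.toOuterMeasure_apply]
  refine tsum_congr fun c => ?_
  cases c <;> simp [Config.isRunning, Set.indicator]

namespace RankingAlgorithm

variable (A : RankingAlgorithm V) (input : V × V)

open Classical in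
/-- The probability that the next action is a query whose answers on `G` and `G'` have different
laws. -/
noncomputable def detection (G G' : Digraph V) : Config V → ℝ≥0∞
  | .stopped _ => 0
  | .running h => (A.next input h).expect fun
      | .inl _ => 0
      | .inr Q => if Q.1 G = Q.1 G' then 0 else 1

theorem detection_comm (G G' : Digraph V) (c : Config V) :
    A.detection input G G' c = A.detection input G' G c := by
  cases c with
  | stopped a => rfl
  | running h =>
    rw [detection, detection]
    congr 1
    funext x
    cases x with
    | inl a => rfl
    | inr Q => dsimp only; split_ifs <;> simp_all

theorem expect_step_stopped (G : Digraph V) (a : V) (g : Config V → ℝ≥0∞) :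
    (A.step G input (.stopped a)).expect g = g (.stopped a) := by
  rw [step, PMF.expect_pure]

theorem expect_step_running (G : Digraph V) (h : History V) (g : Config V → ℝ≥0∞) :
    (A.step G input (.running h)).expect g = (A.next input h).expect fun
      | .inl a => g (.stopped a)
      | .inr Q => (Q.1 G).expect fun S => g (.running (h ++ [(Q.1, S)])) := by
  rw [step, PMF.expect_bind]
  congr 1
  funext x
  cases x with
  | inl a => simp [PMF.expect_pure]
  | inr Q => simp [PMF.expect_map]

/-- The next action has the same law on both graphs; only the answer to a distinguishing query can
differ, and there the trivial bound `1` is paid. -/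
theorem expect_step_le (G G' : Digraph V) (c : Config V) {g : Config V → ℝ≥0∞}
    (hg : ∀ c, g c ≤ 1) :
    (A.step G input c).expect g ≤ (A.step G' input c).expect g + A.detection input G G' c := by
  cases c with
  | stopped a => simp [expect_step_stopped]
  | running h =>
    rw [expect_step_running, expect_step_running, detection, ← PMF.expect_add]
    refine PMF.expect_mono _ fun x => ?_
    cases x with
    | inl a => simp
    | inr Q =>
      dsimp only
      split_ifs with hQ
      · rw [hQ, add_zero]
      · exact (PMF.expect_le_one _ fun S => hg _).trans le_add_self

/-- The expected number of the first `t` actions on `G` that are queries distinguishing `G`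
from `G'`. -/
noncomputable def detections (G G' : Digraph V) (t : ℕ) : ℝ≥0∞ :=
  ∑ s ∈ Finset.range t, (A.run G input s).expect (A.detection input G G')

theorem detections_mono (G G' : Digraph V) : Monotone (A.detections input G G') := by
  intro s t hst
  exact Finset.sum_le_sum_of_subset (Finset.range_mono hst)

theorem expect_run_succ (G : Digraph V) (t : ℕ) (g : Config V → ℝ≥0∞) :
    (A.run G input (t + 1)).expect g
      = (A.run G input t).expect fun c => (A.step G input c).expect g := by
  rw [run, PMF.expect_bind]

/-- The first `t` steps are moved to `G` before the last one is exchanged, so detections are counted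
along the run on `G` only. A single base run thus serves a whole family of graphs `G'`. -/
theorem expect_run_le (G G' : Digraph V) (t : ℕ) :
    ∀ g : Config V → ℝ≥0∞, (∀ c, g c ≤ 1) →
      (A.run G' input t).expect g ≤ (A.run G input t).expect g + A.detections input G G' t := by
  induction t with
  | zero => intro g hg; simp [run]
  | succ t ih =>
    intro g hg
    rw [expect_run_succ, expect_run_succ, detections, Finset.sum_range_succ, ← detections]
    refine (ih _ fun c => PMF.expect_le_one _ hg).trans ?_
    rw [add_comm (A.detections input G G' t), ← add_assoc, ← PMF.expect_add]
    gcongr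
    refine PMF.expect_mono _ fun c => ?_
    rw [detection_comm]
    exact A.expect_step_le input G' G c hg

/-- For the reverse comparison the last step is exchanged first, so that detections are again
counted under the law on `G`. -/
theorem expect_run_le' (G G' : Digraph V) (t : ℕ) :
    ∀ g : Config V → ℝ≥0∞, (∀ c, g c ≤ 1) →
      (A.run G input t).expect g ≤ (A.run G' input t).expect g + A.detections input G G' t := by
  induction t with
  | zero => intro g hg; simp [run]
  | succ t ih =>
    intro g hg
    rw [expect_run_succ, expect_run_succ, detections, Finset.sum_range_succ, ← detections]
    calc _ ≤ (A.run G input t).expect (fun c => (A.step G' input c).expect g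
              + A.detection input G G' c) :=
            PMF.expect_mono _ fun c => A.expect_step_le input G G' c hg
      _ = (A.run G input t).expect (fun c => (A.step G' input c).expect g)
            + (A.run G input t).expect (A.detection input G G') := PMF.expect_add _ _ _
      _ ≤ _ := by
          rw [← add_assoc]
          gcongr
          exact ih _ fun c => PMF.expect_le_one _ hg

/-- The probability that at least `t` queries are asked. -/
noncomputable def runningProb (G : Digraph V) (t : ℕ) : ℝ≥0∞ :=
  (A.run G input t).expect Config.isRunning

theorem expectedQueries_eq (G : Digraph V) :
    A.expectedQueries G input = ∑' t, A.runningProb input G (t + 1) := by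
  simp only [expectedQueries, runningProb, expect_isRunning]

theorem runningProb_le_one (G : Digraph V) (t : ℕ) : A.runningProb input G t ≤ 1 :=
  PMF.expect_le_one _ Config.isRunning_le_one

theorem runningProb_antitone (G : Digraph V) : Antitone (A.runningProb input G) := by
  refine antitone_nat_of_succ_le fun t => ?_
  rw [runningProb, expect_run_succ]
  refine PMF.expect_mono _ fun c => ?_
  cases c with
  | stopped a => rw [expect_step_stopped]
  | running h => exact PMF.expect_le_one _ Config.isRunning_le_one

theorem sum_runningProb_le (G : Digraph V) (t : ℕ) :
    ∑ s ∈ Finset.range t, A.runningProb input G (s + 1) ≤ A.expectedQueries G input := by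
  rw [expectedQueries_eq]
  exact ENNReal.sum_le_tsum _

/-- Markov's inequality for the number of queries. -/
theorem mul_runningProb_le (G : Digraph V) (t : ℕ) :
    t * A.runningProb input G t ≤ A.expectedQueries G input := by
  refine le_trans ?_ (A.sum_runningProb_le input G t)
  calc (t : ℝ≥0∞) * A.runningProb input G t
      = ∑ s ∈ Finset.range t, A.runningProb input G t := by simp
    _ ≤ _ := Finset.sum_le_sum fun s hs =>
        A.runningProb_antitone input G (Finset.mem_range.1 hs)

/-- Only mass that is still running at time `t` can later turn into the answer `a`. -/
theorem probAnswer_le (G : Digraph V) (a : V) (t : ℕ) :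
    A.probAnswer G input a ≤ A.run G input t (.stopped a) + A.runningProb input G t := by
  have hanti : Antitone fun t => (A.run G input t).expect
      fun c => c.isStopped a + c.isRunning := by
    refine antitone_nat_of_succ_le fun t => ?_
    rw [expect_run_succ]
    refine PMF.expect_mono _ fun c => ?_
    cases c with
    | stopped b => rw [expect_step_stopped]
    | running h =>
      simp only [Config.isStopped, Config.isRunning, zero_add]
      refine PMF.expect_le_one _ fun c => ?_
      cases c with
      | running h => exact (zero_add (1 : ℝ≥0∞)).le
      | stopped b => exact (add_zero _).trans_le (Config.isStopped_le_one a (.stopped b))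
  have hmono : Monotone fun t => A.run G input t (.stopped a) := by
    refine monotone_nat_of_le_succ fun t => ?_
    rw [← expect_isStopped, ← expect_isStopped, expect_run_succ]
    refine PMF.expect_mono _ fun c => ?_
    cases c with
    | stopped b => rw [expect_step_stopped]
    | running h => simp [Config.isStopped]
  refine iSup_le fun s => ?_
  calc A.run G input s (.stopped a) ≤ A.run G input (max s t) (.stopped a) :=
        hmono (le_max_left _ _)
    _ ≤ (A.run G input (max s t)).expect (fun c => c.isStopped a + c.isRunning) := by
        rw [PMF.expect_add, expect_isStopped]; exact le_self_add
    _ ≤ (A.run G input t).expect (fun c => c.isStopped a + c.isRunning) :=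
        hanti (le_max_right _ _)
    _ = _ := by rw [PMF.expect_add, expect_isStopped, runningProb]

/-- A detection needs a query to be asked, which is the event of still running after the step, and a
query counts for at most `M` indices. -/
theorem sum_detection_le {ι : Type*} [Fintype ι] (G : Digraph V) (H : ι → Digraph V) (M : ℕ)
    (hM : ∀ (K : Set V) (Q : Query V), Q.IsNatural K → {i | Q G ≠ Q (H i)}.ncard ≤ M)
    (c : Config V) :
    ∑ i, A.detection input G (H i) c ≤ M * (A.step G input c).expect Config.isRunning := by
  classical
  cases c with
  | stopped a => simp [detection]
  | running h =>
    rw [expect_step_running, ← PMF.expect_const_mul]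
    simp only [detection]
    rw [← PMF.expect_finset_sum]
    refine PMF.expect_mono _ fun x => ?_
    cases x with
    | inl a => simp
    | inr Q =>
      simp only [Config.isRunning, PMF.expect_const, mul_one]
      have h1 := hM _ Q.1 Q.2
      rw [Set.ncard_eq_toFinset_card'] at h1
      calc (∑ i, if Q.1 G = Q.1 (H i) then (0 : ℝ≥0∞) else 1)
          = ((Finset.univ.filter fun i => Q.1 G ≠ Q.1 (H i)).card : ℝ≥0∞) := by
            rw [Finset.card_filter]
            push_cast
            exact Finset.sum_congr rfl fun i _ => by split_ifs <;> simp_all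
        _ ≤ M := by
            refine Nat.cast_le.2 (le_trans (le_of_eq ?_) h1)
            congr 1
            ext i
            simp

theorem sum_detections_le {ι : Type*} [Fintype ι] (G : Digraph V) (H : ι → Digraph V) (M : ℕ)
    (hM : ∀ (K : Set V) (Q : Query V), Q.IsNatural K → {i | Q G ≠ Q (H i)}.ncard ≤ M) (t : ℕ) :
    ∑ i, A.detections input G (H i) t
      ≤ M * ∑ s ∈ Finset.range t, A.runningProb input G (s + 1) := by
  simp only [detections]
  rw [Finset.sum_comm, Finset.mul_sum]
  refine Finset.sum_le_sum fun s _ => ?_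
  rw [← PMF.expect_finset_sum, runningProb, expect_run_succ, ← PMF.expect_const_mul]
  exact PMF.expect_mono _ fun c => A.sum_detection_le input G H M hM c

/-- If every query distinguishes the base graph `G` from few members of a family `H`, then an
algorithm that answers well on average over the family asks many queries on average. -/
theorem sum_probAnswer_le {ι : Type*} [Fintype ι] (G : Digraph V) (H : ι → Digraph V) (M : ℕ)
    (hM : ∀ (K : Set V) (Q : Query V), Q.IsNatural K → {i | Q G ≠ Q (H i)}.ncard ≤ M)
    (θ : ℕ) (hθ : 2 * θ * M ≤ Fintype.card ι) (a : ι → V)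
    (ha : ∀ μ : PMF (Config V), 2 * ∑ i, μ (.stopped (a i)) ≤ Fintype.card ι) :
    2 * θ * ∑ i, A.probAnswer (H i) input (a i)
      ≤ θ * Fintype.card ι + 4 * ∑ i, A.expectedQueries (H i) input := by
  set R := ∑ s ∈ Finset.range θ, A.runningProb input G (s + 1) with hR
  set E := ∑ i, A.expectedQueries (H i) input with hE
  set D := ∑ i, A.detections input G (H i) θ with hD
  set N : ℝ≥0∞ := (Fintype.card ι : ℝ≥0∞) with hN
  have hRfin : R ≠ ⊤ := by
    refine ne_top_of_le_ne_top (ENNReal.natCast_ne_top θ) ?_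
    calc R ≤ ∑ s ∈ Finset.range θ, 1 :=
          Finset.sum_le_sum fun s _ => A.runningProb_le_one input G _
      _ = θ := by simp
  have hDR : D ≤ M * R := A.sum_detections_le input G H M hM θ
  have hMN : 2 * θ * (M : ℝ≥0∞) ≤ N := by rw [hN]; exact_mod_cast hθ
  -- Each of the `θ` terms of `R` is transferred to `H i` at the price of the detections for `i`.
  have hNR : N * R ≤ E + θ * D := by
    rw [hE, hD, Finset.mul_sum (f := fun i => A.detections input G (H i) θ),
      ← Finset.sum_add_distrib]
    calc N * R = ∑ i : ι, R := by simp [hN]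
      _ ≤ _ := Finset.sum_le_sum fun i _ => ?_
    calc R ≤ ∑ s ∈ Finset.range θ, (A.runningProb input (H i) (s + 1)
            + A.detections input G (H i) θ) := by
          refine Finset.sum_le_sum fun s hs => ?_
          refine (A.expect_run_le' input G (H i) (s + 1) _ Config.isRunning_le_one).trans ?_
          gcongr
          · exact le_rfl
          · exact A.detections_mono input G (H i) (Finset.mem_range.1 hs)
      _ ≤ _ := by
          rw [Finset.sum_add_distrib]
          gcongr
          · exact A.sum_runningProb_le input (H i) θ
          · simp
  -- The error satisfies `θ * D ≤ θ * M * R ≤ N * R / 2` and is absorbed on the left; the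
  -- cancellation needs `R` finite.
  have hNR2 : N * R ≤ 2 * E := by
    have h1 : N * R + N * R ≤ 2 * E + N * R := by
      calc N * R + N * R = 2 * (N * R) := by ring
        _ ≤ 2 * (E + θ * (M * R)) := by gcongr; exact hNR.trans (by gcongr)
        _ = 2 * E + 2 * θ * M * R := by ring
        _ ≤ 2 * E + N * R := by gcongr
    exact (ENNReal.add_le_add_iff_right
      (ENNReal.mul_ne_top (ENNReal.natCast_ne_top _) hRfin)).1 h1
  have hprob : ∀ i, A.probAnswer (H i) input (a i) ≤ A.run G input θ (.stopped (a i))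
      + A.detections input G (H i) θ + A.runningProb input (H i) θ := by
    intro i
    refine (A.probAnswer_le input (H i) (a i) θ).trans ?_
    gcongr
    rw [← expect_isStopped, ← expect_isStopped]
    exact A.expect_run_le input G (H i) θ _ (Config.isStopped_le_one _)
  calc 2 * θ * ∑ i, A.probAnswer (H i) input (a i)
      ≤ 2 * θ * ∑ i, (A.run G input θ (.stopped (a i))
        + A.detections input G (H i) θ + A.runningProb input (H i) θ) := by
        gcongr with i; exact hprob i
    _ = θ * (2 * ∑ i, A.run G input θ (.stopped (a i))) + 2 * θ * D
        + 2 * ∑ i, θ * A.runningProb input (H i) θ := by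
        rw [Finset.sum_add_distrib, Finset.sum_add_distrib, ← Finset.mul_sum]; ring
    _ ≤ θ * N + 2 * E + 2 * E := by
        -- The three terms are the guess on the base graph, the detections, and runs that reach `θ`
        -- queries.
        refine add_le_add (add_le_add ?_ ?_) ?_
        · gcongr
          exact ha _
        · calc 2 * θ * D ≤ 2 * θ * (M * R) := by gcongr
            _ = 2 * θ * M * R := by ring
            _ ≤ N * R := by gcongr
            _ ≤ 2 * E := hNR2
        · gcongr
          exact Finset.sum_le_sum fun i _ => A.mul_runningProb_le input (H i) θ
    _ = _ := by ring

end RankingAlgorithm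

end PageRankLB

namespace PageRankLB

/-! ### The hard instances -/

/-- The nodes of the hard instances: two paths of length `h + 1` ending in the nodes to be ranked,
for each of them `k` cells consisting of a parent of the start of the path (number `0`) and `d`
dummy nodes, `B` blocks of `m` nodes, and `r` further nodes. -/
inductive Node (h k d B m r : ℕ) : Type
  | path (s : Bool) (i : Fin (h + 2))
  | cell (s : Bool) (i : Fin k) (j : Fin (d + 1))
  | block (b : Fin B) (a : Fin m)
  | filler (c : Fin r)

namespace Node

variable {h k d B m r : ℕ}

/-- `Node` as a sum type. -/
def equivSum : Node h k d B m r ≃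
    (Bool × Fin (h + 2)) ⊕ (Bool × Fin k × Fin (d + 1)) ⊕ (Fin B × Fin m) ⊕ Fin r where
  toFun
    | path s i => .inl (s, i)
    | cell s i j => .inr (.inl (s, i, j))
    | block b a => .inr (.inr (.inl (b, a)))
    | filler c => .inr (.inr (.inr c))
  invFun
    | .inl (s, i) => path s i
    | .inr (.inl (s, i, j)) => cell s i j
    | .inr (.inr (.inl (b, a))) => block b a
    | .inr (.inr (.inr c)) => filler c
  left_inv x := by cases x <;> rfl
  right_inv x := by rcases x with x | x | x | x <;> rfl

noncomputable instance : Fintype (Node h k d B m r) := Fintype.ofEquiv _ equivSum.symm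

theorem card_eq : Fintype.card (Node h k d B m r)
    = 2 * (h + 2) + 2 * (k * (d + 1)) + B * m + r := by
  rw [Fintype.card_congr equivSum]
  simp
  ring

theorem sum_eq (F : Node h k d B m r → ℝ) :
    ∑ x, F x = ∑ s, ∑ i, F (path s i) + ∑ s, ∑ i, ∑ j, F (cell s i j)
      + ∑ b, ∑ a, F (block b a) + ∑ c, F (filler c) := by
  rw [← Equiv.sum_comp equivSum.symm F]
  simp only [Fintype.sum_sum_type, Fintype.sum_prod_type, equivSum, Equiv.coe_fn_symm_mk]
  ring

end Node

open Node

variable {h k d B m r : ℕ}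

/-- The hard instance with selected cell and block `sel`, or the base graph if `sel` is `none`. -/
def gadget (sel : Option (Bool × Fin k × Fin B)) : Digraph (Node h k d B m r) where
  Adj
    -- Truncated subtraction gives the ranked node, number `0`, a self-loop.
    | .path s i, y => y = .path s ⟨i.1 - 1, by omega⟩
    | .cell s i j, y =>
      (j = 0 ∧ y = .path s (Fin.last _)) ∨
      (j = 0 ∧ (∀ q, sel ≠ some (s, i, q)) ∧ ∃ j', j' ≠ 0 ∧ y = .cell s i j') ∨
      (j ≠ 0 ∧ y = .cell s i j)
    | .block b a, y =>
      (∃ s i, sel = some (s, i, b) ∧ y = .cell s i 0) ∨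
      ((∀ s i, sel ≠ some (s, i, b)) ∧ y = .block b a)
    | .filler c, y => y = .filler c

/-! ### Outdegrees in the hard instances. -/

theorem outdegree_eq_one {V : Type} {G : Digraph V} {x z : V} (hx : ∀ y, G.Adj x y ↔ y = z) :
    outdegree G x = 1 := by
  rw [outdegree, Set.ncard_eq_one]
  exact ⟨z, by ext y; simp [hx]⟩

theorem outdegree_path (sel : Option (Bool × Fin k × Fin B)) (s : Bool) (i : Fin (h + 2)) :
    outdegree (gadget sel : Digraph (Node h k d B m r)) (.path s i) = 1 :=
  outdegree_eq_one fun _ => Iff.rfl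

theorem outdegree_filler (sel : Option (Bool × Fin k × Fin B)) (c : Fin r) :
    outdegree (gadget sel : Digraph (Node h k d B m r)) (.filler c) = 1 :=
  outdegree_eq_one fun _ => Iff.rfl

theorem outdegree_block (sel : Option (Bool × Fin k × Fin B)) (b : Fin B) (a : Fin m) :
    outdegree (gadget sel : Digraph (Node h k d B m r)) (.block b a) = 1 := by
  by_cases hb : ∃ s i, sel = some (s, i, b)
  · obtain ⟨s, i, rfl⟩ := hb
    refine outdegree_eq_one (z := .cell s i 0) fun y => ?_
    simp only [gadget]
    grind
  · refine outdegree_eq_one (z := .block b a) fun y => ?_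
    simp only [gadget]
    grind

theorem outdegree_dummy (sel : Option (Bool × Fin k × Fin B)) (s : Bool) (i : Fin k)
    (j : Fin (d + 1)) (hj : j ≠ 0) :
    outdegree (gadget sel : Digraph (Node h k d B m r)) (.cell s i j) = 1 := by
  refine outdegree_eq_one (z := .cell s i j) fun y => ?_
  simp only [gadget]
  grind

theorem outdegree_selected (s : Bool) (i : Fin k) (q : Fin B) :
    outdegree (gadget (some (s, i, q)) : Digraph (Node h k d B m r)) (.cell s i 0) = 1 := by
  refine outdegree_eq_one (z := .path s (Fin.last _)) fun y => ?_
  simp only [gadget]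
  grind

theorem outdegree_unselected (sel : Option (Bool × Fin k × Fin B)) (s : Bool) (i : Fin k)
    (hi : ∀ q, sel ≠ some (s, i, q)) :
    outdegree (gadget sel : Digraph (Node h k d B m r)) (.cell s i 0) = d + 1 := by
  set g : Fin (d + 1) → Node h k d B m r := fun j =>
    if j = 0 then .path s (Fin.last _) else .cell s i j with hg
  have hinj : Function.Injective g := by
    intro j j' hjj
    simp only [hg] at hjj
    grind
  have hset : {w | (gadget sel : Digraph (Node h k d B m r)).Adj (.cell s i 0) w}
      = Set.range g := by
    ext y
    change (_ ∨ _ ∨ _) ↔ ∃ j, g j = y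
    simp only [hg]
    constructor
    · rintro (⟨-, rfl⟩ | ⟨-, -, j', hj', rfl⟩ | ⟨h0, -⟩)
      · exact ⟨0, by simp⟩
      · exact ⟨j', by simp [hj']⟩
      · exact absurd rfl h0
    · rintro ⟨j, rfl⟩
      split_ifs with hj
      · exact Or.inl ⟨by trivial, rfl⟩
      · exact Or.inr (Or.inl ⟨by trivial, hi, j, hj, rfl⟩)
  rw [outdegree, hset, ← Set.image_univ, Set.ncard_image_of_injective _ hinj, Set.ncard_univ]
  simp

theorem outdegree_gadget (sel : Option (Bool × Fin k × Fin B)) (x : Node h k d B m r) :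
    outdegree (gadget sel) x = 1 ∨ outdegree (gadget sel) x = d + 1 := by
  cases x with
  | path s i => exact Or.inl (outdegree_path sel s i)
  | filler c => exact Or.inl (outdegree_filler sel c)
  | block b a => exact Or.inl (outdegree_block sel b a)
  | cell s i j =>
    by_cases hj : j = 0
    · subst hj
      by_cases hi : ∃ q, sel = some (s, i, q)
      · obtain ⟨q, rfl⟩ := hi
        exact Or.inl (outdegree_selected s i q)
      · exact Or.inr (outdegree_unselected sel s i fun q hq => hi ⟨q, hq⟩)
    · exact Or.inl (outdegree_dummy sel s i j hj)

/-! ### PageRank scores in the hard instances. -/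

theorem walkMatrix_of_not_adj {V : Type} [Fintype V] {G : Digraph V} {x y : V}
    (hx : outdegree G x ≠ 0) (hxy : ¬ G.Adj x y) : walkMatrix G x y = 0 := by
  simp [walkMatrix, hx, hxy]

theorem walkMatrix_of_adj {V : Type} [Fintype V] {G : Digraph V} {x y : V}
    (hx : outdegree G x ≠ 0) (hxy : G.Adj x y) : walkMatrix G x y = (outdegree G x : ℝ)⁻¹ := by
  simp [walkMatrix, hx, hxy]

theorem pageRank_apply {V : Type} [Fintype V] {α : ℝ} (h0 : 0 < α) (h1 : α < 1)
    (G : Digraph V) (y : V) :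
    pageRank α G y = (1 - α) * (Fintype.card V : ℝ)⁻¹
      + α * ∑ x, pageRank α G x * walkMatrix G x y := by
  have hP := (isPageRank_iff h0 h1 G _).2 rfl
  have := congrFun hP y
  rw [add_comm]
  simpa [Matrix.vecMul, dotProduct] using this

section PageRank

variable {α : ℝ}

theorem gadget_walkMatrix_eq_zero {sel : Option (Bool × Fin k × Fin B)}
    {x y : Node h k d B m r} (hxy : ¬ (gadget sel).Adj x y) : walkMatrix (gadget sel) x y = 0 := by
  refine walkMatrix_of_not_adj ?_ hxy
  rcases outdegree_gadget sel x with hx | hx <;> rw [hx] <;> omega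

theorem gadget_walkMatrix_eq_inv {sel : Option (Bool × Fin k × Fin B)}
    {x y : Node h k d B m r} (hxy : (gadget sel).Adj x y) :
    walkMatrix (gadget sel) x y = (outdegree (gadget sel) x : ℝ)⁻¹ := by
  refine walkMatrix_of_adj ?_ hxy
  rcases outdegree_gadget sel x with hx | hx <;> rw [hx] <;> omega

/-- Redirection removes the self-loops of the selected block, so its nodes have no parents and keep
only the teleport mass. -/
theorem pageRank_block (h0 : 0 < α) (h1 : α < 1) (t : Bool) (p : Fin k) (q : Fin B) (a : Fin m) :
    pageRank α (gadget (some (t, p, q)) : Digraph (Node h k d B m r)) (.block q a)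
      = ((1 - α) * (Fintype.card (Node h k d B m r) : ℝ)⁻¹) := by
  rw [pageRank_apply h0 h1, Finset.sum_eq_zero, mul_zero, add_zero]
  intro x _
  rw [gadget_walkMatrix_eq_zero, mul_zero]
  cases x with
  | block b a' =>
    simp only [gadget]
    rintro (⟨_, _, _, h⟩ | ⟨h, h'⟩)
    · cases h
    · cases h'
      exact h t p rfl
  | _ => simp only [gadget]; grind

theorem pageRank_unselected (h0 : 0 < α) (h1 : α < 1)
    (t : Bool) (p : Fin k) (q : Fin B) (s : Bool) (i : Fin k)
    (hsi : ¬ (s = t ∧ i = p)) :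
    pageRank α (gadget (some (t, p, q)) : Digraph (Node h k d B m r)) (.cell s i 0)
      = ((1 - α) * (Fintype.card (Node h k d B m r) : ℝ)⁻¹) := by
  rw [pageRank_apply h0 h1, Finset.sum_eq_zero, mul_zero, add_zero]
  intro x _
  rw [gadget_walkMatrix_eq_zero, mul_zero]
  cases x <;> simp only [gadget] <;> grind

theorem pageRank_selected (h0 : 0 < α) (h1 : α < 1) (t : Bool) (p : Fin k) (q : Fin B) :
    pageRank α (gadget (some (t, p, q)) : Digraph (Node h k d B m r)) (.cell t p 0)
      = ((1 - α) * (Fintype.card (Node h k d B m r) : ℝ)⁻¹) * (1 + α * m) := by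
  set G : Digraph (Node h k d B m r) := gadget (some (t, p, q)) with hG
  have hpath : ∀ s i, walkMatrix G (.path s i) (.cell t p 0) = 0 := fun s i =>
    gadget_walkMatrix_eq_zero (by simp only [gadget]; grind)
  have hcell : ∀ s i j, walkMatrix G (.cell s i j) (.cell t p 0) = 0 := fun s i j =>
    gadget_walkMatrix_eq_zero (by simp only [gadget]; grind)
  have hfiller : ∀ c, walkMatrix G (.filler c) (.cell t p 0) = 0 := fun c =>
    gadget_walkMatrix_eq_zero (by simp only [gadget]; grind)
  have hblock : ∀ b, b ≠ q → ∀ a, walkMatrix G (.block b a) (.cell t p 0) = 0 := fun b hb a =>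
    gadget_walkMatrix_eq_zero (by simp only [gadget]; grind)
  have hblockP : ∀ a, pageRank α G (.block q a)
    = ((1 - α) * (Fintype.card (Node h k d B m r) : ℝ)⁻¹) := pageRank_block h0 h1 t p q
  have hblock' : ∀ a, walkMatrix G (.block q a) (.cell t p 0) = 1 := fun a => by
    rw [hG, gadget_walkMatrix_eq_inv (by simp only [gadget]; grind), outdegree_block]
    simp
  rw [pageRank_apply h0 h1, Node.sum_eq, Finset.sum_eq_single (f := fun b => ∑ a, _) q]
  · simp only [hpath, hcell, hfiller, hblock', hblockP]
    simp
    ring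
  · intro b _ hb
    simp [hblock b hb]
  · simp

/-- An unselected parent splits its teleport mass among `d + 1` children; the selected one passes on
its own mass and that of its block undivided. -/
theorem pageRank_path_last (h0 : 0 < α) (h1 : α < 1) (t : Bool) (p : Fin k) (q : Fin B) (s : Bool) :
    pageRank α (gadget (some (t, p, q)) : Digraph (Node h k d B m r)) (.path s (Fin.last _))
      = ((1 - α) * (Fintype.card (Node h k d B m r) : ℝ)⁻¹)
          * (1 + α * ∑ i : Fin k, if s = t ∧ i = p then 1 + α * m else (d + 1 : ℝ)⁻¹) := by
  set G : Digraph (Node h k d B m r) := gadget (some (t, p, q)) with hG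
  have hpath : ∀ s' i, walkMatrix G (.path s' i) (.path s (Fin.last _)) = 0 := fun s' i =>
    gadget_walkMatrix_eq_zero (by
      simp only [gadget, Node.path.injEq, Fin.ext_iff, Fin.val_last]; omega)
  have hdummy : ∀ s' i j, j ≠ 0 → walkMatrix G (.cell s' i j) (.path s (Fin.last _)) = 0 :=
    fun s' i j hj => gadget_walkMatrix_eq_zero (by simp only [gadget]; grind)
  have hother : ∀ s', s' ≠ s → ∀ i j, walkMatrix G (.cell s' i j) (.path s (Fin.last _)) = 0 :=
    fun s' hs i j => gadget_walkMatrix_eq_zero (by simp only [gadget]; grind)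
  have hfiller : ∀ c, walkMatrix G (.filler c) (.path s (Fin.last _)) = 0 := fun c =>
    gadget_walkMatrix_eq_zero (by simp only [gadget]; grind)
  have hblock : ∀ b a, walkMatrix G (.block b a) (.path s (Fin.last _)) = 0 := fun b a =>
    gadget_walkMatrix_eq_zero (by simp only [gadget]; grind)
  have hcell : ∀ i, pageRank α G (.cell s i 0) * walkMatrix G (.cell s i 0) (.path s (Fin.last _))
      = ((1 - α) * (Fintype.card (Node h k d B m r) : ℝ)⁻¹)
          * if s = t ∧ i = p then 1 + α * m else (d + 1 : ℝ)⁻¹ := fun i => by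
    rw [hG, gadget_walkMatrix_eq_inv (by simp only [gadget]; grind)]
    split_ifs with hs
    · obtain ⟨rfl, rfl⟩ := hs
      rw [pageRank_selected h0 h1, outdegree_selected]
      simp
    · rw [pageRank_unselected h0 h1 _ _ _ _ _ hs, outdegree_unselected _ _ _ (by grind)]
      simp
  have hsum : ∑ s', ∑ i, ∑ j, pageRank α G (.cell s' i j)
      * walkMatrix G (.cell s' i j) (.path s (Fin.last _))
      = ∑ i,
        ((1 - α) * (Fintype.card (Node h k d B m r) : ℝ)⁻¹) * if s = t ∧ i = p then 1 + α * m else (d + 1 : ℝ)⁻¹ := by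
    rw [Finset.sum_eq_single s (by intro s' _ hs; simp [hother s' hs]) (by simp)]
    refine Finset.sum_congr rfl fun i _ => ?_
    rw [Finset.sum_eq_single 0 (by intro j _ hj; simp [hdummy s i j hj]) (by simp), hcell]
  rw [pageRank_apply h0 h1, Node.sum_eq, hsum, ← Finset.mul_sum]
  simp only [hpath, hfiller, hblock]
  simp
  ring

theorem pageRank_path_succ (h0 : 0 < α) (h1 : α < 1)
    (sel : Option (Bool × Fin k × Fin B)) (s : Bool) (i : ℕ)
    (hi : i + 2 < h + 2) :
    pageRank α (gadget sel : Digraph (Node h k d B m r)) (.path s ⟨i + 1, by omega⟩)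
      = ((1 - α) * (Fintype.card (Node h k d B m r) : ℝ)⁻¹)
          + α * pageRank α (gadget sel : Digraph (Node h k d B m r)) (.path s ⟨i + 2, hi⟩) := by
  rw [pageRank_apply h0 h1, Finset.sum_eq_single (.path s ⟨i + 2, hi⟩)]
  · rw [gadget_walkMatrix_eq_inv (by simp [gadget]), outdegree_path]
    simp
  · intro x _ hx
    rw [gadget_walkMatrix_eq_zero, mul_zero]
    cases x with
    | path s' i' => simp only [gadget, Node.path.injEq, Fin.ext_iff] at hx ⊢; grind
    | cell s' i' j => simp only [gadget, Node.path.injEq, Fin.ext_iff, Fin.val_last]; grind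
    | block b a => simp only [gadget]; grind
    | filler c => simp only [gadget]; grind
  · simp

theorem pageRank_path_zero (h0 : 0 < α) (h1 : α < 1)
    (sel : Option (Bool × Fin k × Fin B)) (s : Bool) :
    (1 - α) * pageRank α (gadget sel : Digraph (Node h k d B m r)) (.path s 0)
      = ((1 - α) * (Fintype.card (Node h k d B m r) : ℝ)⁻¹)
          + α * pageRank α (gadget sel : Digraph (Node h k d B m r)) (.path s 1) := by
  have := pageRank_apply h0 h1 (gadget sel : Digraph (Node h k d B m r)) (.path s 0)
  rw [Finset.sum_eq_add (.path s 0) (.path s 1)] at this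
  · rw [gadget_walkMatrix_eq_inv (by simp [gadget]), outdegree_path,
      gadget_walkMatrix_eq_inv (by simp [gadget]), outdegree_path] at this
    simp only [Nat.cast_one, inv_one, mul_one] at this
    linear_combination this
  · simp
  · rintro x _ ⟨hx, hx'⟩
    rw [gadget_walkMatrix_eq_zero, mul_zero]
    cases x with
    | path s' i' =>
      simp only [gadget, Node.path.injEq, Fin.ext_iff, Fin.val_zero, Fin.val_one, ne_eq] at hx hx' ⊢
      grind
    | cell s' i' j => simp only [gadget, Node.path.injEq, Fin.ext_iff, Fin.val_last]; grind
    | block b a => simp only [gadget]; grind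
    | filler c => simp only [gadget]; grind
  · simp
  · simp

theorem pageRank_path (h0 : 0 < α) (h1 : α < 1)
    (sel : Option (Bool × Fin k × Fin B)) (s : Bool) (i : ℕ)
    (hi : i + 1 < h + 2) :
    (1 - α) * pageRank α (gadget sel : Digraph (Node h k d B m r)) (.path s 0)
      = ((1 - α) * (Fintype.card (Node h k d B m r) : ℝ)⁻¹) * ∑ j ∈ Finset.range (i + 1), α ^ j + α ^ (i + 1)
        * pageRank α (gadget sel : Digraph (Node h k d B m r)) (.path s ⟨i + 1, hi⟩) := by
  induction i with
  | zero =>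
    rw [pageRank_path_zero h0 h1]
    simp
  | succ i ih =>
    rw [ih (by omega), pageRank_path_succ h0 h1 sel s i hi, Finset.sum_range_succ _ (i + 1)]
    ring

/-- The self-loop at the end of the path produces a factor `1 - α` that cancels the one in the
teleport mass. -/
theorem card_mul_pageRank (h0 : 0 < α) (h1 : α < 1) (t : Bool) (p : Fin k) (q : Fin B) (s : Bool) :
    Fintype.card (Node h k d B m r)
        * pageRank α (gadget (some (t, p, q)) : Digraph (Node h k d B m r)) (.path s 0)
      = ∑ j ∈ Finset.range (h + 1), α ^ j + α ^ (h + 1)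
        * (1 + α * ∑ i : Fin k, if s = t ∧ i = p then 1 + α * m else (d + 1 : ℝ)⁻¹) := by
  have hn : (Fintype.card (Node h k d B m r) : ℝ) ≠ 0 :=
    Nat.cast_ne_zero.2 (@Fintype.card_ne_zero _ _ ⟨Node.path s 0⟩)
  have hα : 1 - α ≠ 0 := by linarith
  have := pageRank_path (h := h) (d := d) (m := m) (r := r) h0 h1
    (some (t, p, q)) s h (by omega)
  have hl := pageRank_path_last (h := h) (d := d) (m := m) (r := r) h0 h1 t p q s
  rw [Fin.last] at hl
  rw [hl] at this
  apply mul_left_cancel₀ hα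
  field_simp at this ⊢
  linear_combination this

theorem card_mul_pageRank_winner (h0 : 0 < α) (h1 : α < 1) (t : Bool) (p : Fin k) (q : Fin B) :
    Fintype.card (Node h k d B m r)
        * pageRank α (gadget (some (t, p, q)) : Digraph (Node h k d B m r)) (.path t 0)
      = ∑ j ∈ Finset.range (h + 1), α ^ j + α ^ (h + 1)
        * (1 + α * ((k - 1) / (d + 1) + (1 + α * m))) := by
  rw [card_mul_pageRank h0 h1]
  congr 3
  have : ∀ i : Fin k, (if t = t ∧ i = p then 1 + α * m else (d + 1 : ℝ)⁻¹)
      = (d + 1 : ℝ)⁻¹ + if i = p then 1 + α * m - (d + 1 : ℝ)⁻¹ else 0 := fun i => by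
    split_ifs <;> simp_all
  rw [Finset.sum_congr rfl fun i _ => this i, Finset.sum_add_distrib, Finset.sum_ite_eq',
    if_pos (Finset.mem_univ p), Finset.sum_const, Finset.card_univ, Fintype.card_fin,
    nsmul_eq_mul]
  ring

theorem card_mul_pageRank_loser (h0 : 0 < α) (h1 : α < 1) (t : Bool) (p : Fin k) (q : Fin B) :
    Fintype.card (Node h k d B m r)
        * pageRank α (gadget (some (t, p, q)) : Digraph (Node h k d B m r)) (.path (!t) 0)
      = ∑ j ∈ Finset.range (h + 1), α ^ j + α ^ (h + 1) * (1 + α * (k / (d + 1))) := by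
  rw [card_mul_pageRank h0 h1]
  simp [div_eq_mul_inv]

end PageRank

/-! ### Distinguishing queries -/

/-- Every arc in which the two graphs differ has both ends in the selected cell or block; the arc
from the selected parent to the path is present in both. -/
theorem gadget_adj_left {sel : Bool × Fin k × Fin B} {w : Node h k d B m r}
    (hc : ∀ j, w ≠ .cell sel.1 sel.2.1 j) (hb : ∀ a, w ≠ .block sel.2.2 a)
    (x : Node h k d B m r) : (gadget none).Adj w x ↔ (gadget (some sel)).Adj w x := by
  obtain ⟨t, p, q⟩ := sel
  cases w <;> simp only [gadget] <;> grind

theorem gadget_adj_right {sel : Bool × Fin k × Fin B} {w : Node h k d B m r}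
    (hc : ∀ j, w ≠ .cell sel.1 sel.2.1 j) (hb : ∀ a, w ≠ .block sel.2.2 a)
    (x : Node h k d B m r) : (gadget none).Adj x w ↔ (gadget (some sel)).Adj x w := by
  obtain ⟨t, p, q⟩ := sel
  cases x <;> simp only [gadget] <;> grind

/-- A node of a cell leaves only the block free, with `B` choices; a node of a block leaves only the
cell free, with `2 * k` choices. -/
theorem ncard_affected_le (w : Node h k d B m r) :
    {sel : Bool × Fin k × Fin B | (∃ j, w = .cell sel.1 sel.2.1 j) ∨
        ∃ a, w = .block sel.2.2 a}.ncard
      ≤ max B (2 * k) := by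
  cases w with
  | path s i => simp
  | filler c => simp
  | cell s i j =>
    refine le_trans ?_ (le_max_left _ _)
    calc _ ≤ (Set.range fun q : Fin B => (s, i, q)).ncard := by
          refine Set.ncard_le_ncard ?_ (Set.toFinite _)
          rintro ⟨t, p, q⟩ hs
          simp at hs ⊢
          grind
      _ ≤ B := by
          rw [← Set.image_univ]
          refine (Set.ncard_image_le (Set.toFinite _)).trans ?_
          simp [Set.ncard_univ]
  | block b a =>
    refine le_trans ?_ (le_max_right _ _)
    calc _ ≤ (Set.range fun x : Bool × Fin k => (x.1, x.2, b)).ncard := by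
          refine Set.ncard_le_ncard ?_ (Set.toFinite _)
          rintro ⟨t, p, q⟩ hs
          simp at hs ⊢
          grind
      _ ≤ 2 * k := by
          rw [← Set.image_univ]
          refine (Set.ncard_image_le (Set.toFinite _)).trans ?_
          simp [Set.ncard_univ]

end PageRankLB

open Filter

namespace PageRankLB

/-! ### Choice of the parameters -/

theorem geom_sum_le_inv {α : ℝ} (h0 : 0 < α) (h1 : α < 1) (N : ℕ) :
    ∑ j ∈ Finset.range N, α ^ j ≤ (1 - α)⁻¹ := by
  rw [← tsum_geometric_of_lt_one h0.le h1]
  exact (summable_geometric_of_lt_one h0.le h1).sum_le_tsum _ fun j _ => by positivity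

/-- There is an exponent `h + 1` for which `α ^ (h + 1)` is about `min 1 y`. -/
theorem exists_pow_succ_le {α y : ℝ} (h0 : 0 < α) (h1 : α < 1) {j : ℕ} (hj : α ^ j ≤ y) :
    ∃ h ≤ j, α ^ (h + 1) ≤ y ∧ α * min 1 y ≤ α ^ (h + 1) := by
  classical
  have hex : ∃ h, α ^ (h + 1) ≤ y :=
    ⟨j, (pow_le_pow_of_le_one h0.le h1.le (Nat.le_succ j)).trans hj⟩
  refine ⟨Nat.find hex, Nat.find_min' hex
    ((pow_le_pow_of_le_one h0.le h1.le (Nat.le_succ j)).trans hj), Nat.find_spec hex, ?_⟩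
  -- If the least exponent is `0`, the `1` in the minimum gives the lower bound; otherwise
  -- minimality does.
  rcases Nat.eq_zero_or_pos (Nat.find hex) with h | h
  · rw [h, zero_add, pow_one]
    nlinarith [min_le_left 1 y]
  · have hm := Nat.find_min hex (Nat.sub_lt h one_pos)
    rw [Nat.sub_add_cancel (show 1 ≤ Nat.find hex from h), not_le] at hm
    rw [pow_succ']
    gcongr
    exact (min_le_right _ _).trans hm.le

theorem eventually_pow_div_le {α : ℝ} (h0 : 0 < α) (h1 : α < 1) :
    ∀ᶠ n : ℕ in atTop, α ^ (n / 8) ≤ 1 / (n : ℝ) := by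
  have ht := tendsto_pow_const_mul_const_pow_of_abs_lt_one 1
    (r := α) (by rwa [abs_of_pos h0])
  have h8 : Tendsto (fun n : ℕ => n / 8) atTop atTop :=
    Nat.tendsto_div_const_atTop (by norm_num)
  have h2 := (ht.comp h8).eventually (gt_mem_nhds (show (0 : ℝ) < 1 / 16 by norm_num))
  filter_upwards [h2, eventually_ge_atTop 8] with n hn hn8
  simp only [Function.comp_apply, pow_one] at hn
  have hx : (0 : ℝ) < n := by exact_mod_cast (by omega : 0 < n)
  have hd : (n : ℝ) ≤ 16 * ((n / 8 : ℕ) : ℝ) := by exact_mod_cast (by omega : n ≤ 16 * (n / 8))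
  rw [le_div_iff₀ hx]
  have hp : 0 < α ^ (n / 8) := by positivity
  nlinarith

/-- The properties of the lower bound used to choose the parameters. -/
theorem min_bound_facts {x F γ : ℝ} (hx : 1 ≤ x) (hF : 0 < F) (hF1 : F ≤ 1) (hγ : 1 ≤ γ) :
    let L := min (1 / F) (min (x ^ (2 / 3 : ℝ)) (x ^ (1 / 2 : ℝ) * γ ^ (1 / 2 : ℝ)))
    1 ≤ L ∧ L * F ≤ 1 ∧ L ^ 3 ≤ x ^ 2 ∧ L ^ 2 ≤ x * γ := by
  intro L
  have hL1 : 1 ≤ L := by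
    refine le_min ?_ (le_min ?_ ?_)
    · rw [le_div_iff₀ hF]; linarith
    · exact Real.one_le_rpow hx (by norm_num)
    · exact one_le_mul_of_one_le_of_one_le (Real.one_le_rpow hx (by norm_num))
        (Real.one_le_rpow hγ (by norm_num))
  have hL0 : 0 ≤ L := by linarith
  refine ⟨hL1, ?_, ?_, ?_⟩
  · rw [← le_div_iff₀ hF]
    exact min_le_left _ _
  · calc L ^ 3 ≤ (x ^ (2 / 3 : ℝ)) ^ 3 := by
          gcongr
          exact (min_le_right _ _).trans (min_le_left _ _)
      _ = x ^ 2 := by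
          rw [← Real.rpow_natCast, ← Real.rpow_mul (by linarith), ← Real.rpow_natCast]
          norm_num
  · calc L ^ 2 ≤ (x ^ (1 / 2 : ℝ) * γ ^ (1 / 2 : ℝ)) ^ 2 := by
          gcongr
          exact (min_le_right _ _).trans (min_le_right _ _)
      _ = x * γ := by
          rw [← Real.sqrt_eq_rpow, ← Real.sqrt_eq_rpow, mul_pow, Real.sq_sqrt (by linarith),
            Real.sq_sqrt (by linarith)]

/-- Sizes of blocks and cells. -/
theorem exists_sizes {x L c : ℝ} (hL : 1 ≤ L) (hL3 : L ^ 3 ≤ x ^ 2) (hc : 0 < c) (hc8 : c ≤ 1 / 8)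
    (hxL : 16 ≤ c * (x / L)) :
    ∃ k d B m : ℕ, 1 ≤ k ∧ 2 ≤ B ∧ L ≤ B ∧ c * L / 32 ≤ k ∧ (d + 1 : ℝ) ≤ L ^ 2 / x + 1 ∧
      x / (16 * L) ≤ m ∧ m ≤ x / (8 * L) ∧ (k : ℝ) / (d + 1) ≤ c * m ∧
      c * m / 2 ≤ (k : ℝ) / (d + 1) ∧ (k * (d + 1) : ℝ) ≤ x / 16 ∧ (B * m : ℝ) ≤ x / 4 := by
  have hL0 : 0 < L := by linarith
  have hq : 128 ≤ x / L := by
    by_contra! hlt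
    have h0 : 0 < x / L := by
      by_contra! hneg
      nlinarith
    nlinarith
  have hx : 0 < x := by
    have := (le_div_iff₀ hL0).1 hq
    nlinarith
  have e8 : x / (8 * L) = x / L / 8 := by field_simp
  have e16 : x / (16 * L) = x / L / 16 := by field_simp
  set q := x / L with hqdef
  have hxq : x = q * L := by rw [hqdef]; field_simp
  set m := ⌊x / (8 * L)⌋₊ with hm
  have hm1 : (m : ℝ) ≤ q / 8 := by rw [← e8]; exact Nat.floor_le (by positivity)
  have hm2 : q / 16 ≤ m := by
    have : x / (8 * L) < m + 1 := Nat.lt_floor_add_one _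
    rw [e8] at this
    linarith
  have hm0 : (0 : ℝ) < m := by linarith
  set B := ⌊x / (4 * m)⌋₊ with hB
  have hB0 : 2 * L ≤ x / (4 * m) := by
    rw [le_div_iff₀ (by positivity)]
    nlinarith
  have hB1 : (B : ℝ) ≤ x / (4 * m) := Nat.floor_le (by positivity)
  have hB2 : x / (4 * m) < B + 1 := Nat.lt_floor_add_one _
  -- The outdegree `d + 1` is about `max 1 (L ^ 2 / x)`, just enough to make `k` of order `L`.
  have hD0 : 0 < ⌈L ^ 2 / x⌉₊ := Nat.ceil_pos.2 (by positivity)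
  obtain ⟨d, hd⟩ : ∃ d, ⌈L ^ 2 / x⌉₊ = d + 1 := ⟨_, (Nat.succ_pred_eq_of_pos hD0).symm⟩
  have hd1 : (d + 1 : ℝ) ≤ L ^ 2 / x + 1 := by
    have := (Nat.ceil_lt_add_one (show 0 ≤ L ^ 2 / x by positivity)).le
    rw [hd] at this
    exact_mod_cast this
  have hd2 : L ^ 2 / x ≤ d + 1 := by
    have := Nat.le_ceil (L ^ 2 / x)
    rw [hd] at this
    exact_mod_cast this
  set D : ℝ := d + 1 with hD
  have hDpos : 1 ≤ D := by rw [hD]; linarith [(Nat.cast_nonneg d : (0 : ℝ) ≤ d)]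
  set k := ⌊c * m * D⌋₊ with hk
  have hk1 : (k : ℝ) ≤ c * m * D := Nat.floor_le (by positivity)
  have hk2 : c * m * D < k + 1 := Nat.lt_floor_add_one _
  -- This keeps the rounding in `k` within a factor of two.
  have hcm : 1 ≤ c * m := by nlinarith
  have hcmD : 1 ≤ c * m * D := by nlinarith
  have hk3 : 1 ≤ k := Nat.le_floor (by simpa using hcmD)
  have hk3' : (1 : ℝ) ≤ k := by exact_mod_cast hk3
  have hk4 : c * m * D / 2 ≤ k := by linarith
  refine ⟨k, d, B, m, hk3, Nat.le_floor (by push_cast; linarith), by linarith, ?_, hd1, ?_, ?_,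
    ?_, ?_, ?_, ?_⟩
  · refine le_trans ?_ hk4
    have h1 : q / 16 * (L ^ 2 / x) ≤ m * D := by gcongr
    have h2 : q / 16 * (L ^ 2 / x) = L / 16 := by rw [hxq]; field_simp
    rw [h2] at h1
    nlinarith
  · rw [e16]; exact hm2
  · rw [e8]; exact hm1
  · rw [div_le_iff₀ (by positivity)]; exact hk1
  · rw [le_div_iff₀ (by positivity)]; linarith
  -- The cells cost about `m * D ^ 2`, that is `L ^ 3 / x + x / L` up to constants; here `L ^ 3 ≤ x
  -- ^ 2` is needed.
  · have hs : (L ^ 2 / x + 1) ^ 2 ≤ 2 * (L ^ 4 / x ^ 2 + 1) := by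
      have : L ^ 4 / x ^ 2 = (L ^ 2 / x) ^ 2 := by field_simp
      rw [this]
      nlinarith [sq_nonneg (L ^ 2 / x - 1)]
    have hL3x : L ^ 3 / x ≤ x := by rw [div_le_iff₀ hx]; nlinarith
    have hqx : q ≤ x := div_le_self hx.le hL
    calc (k : ℝ) * D ≤ c * m * D * D := by gcongr
      _ ≤ 1 / 8 * (q / 8) * (D * D) := by
          rw [mul_assoc]
          gcongr
      _ ≤ 1 / 8 * (q / 8) * (2 * (L ^ 4 / x ^ 2 + 1)) := by
          refine mul_le_mul_of_nonneg_left (le_trans ?_ hs) (by positivity)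
          rw [← pow_two]
          gcongr
      _ = 1 / 32 * (L ^ 3 / x + q) := by rw [hxq]; field_simp; ring
      _ ≤ x / 16 := by linarith
  · rw [le_div_iff₀ (by positivity)] at hB1
    linarith

/-- The scores of the two ranked nodes, for abstract values of the parameters. -/
theorem score_bounds {α η c g s S ε m ρ ρ' X : ℝ} (h0 : 0 < α) (h1 : α < 1) (hη : 0 < η)
    (hc0 : 0 < c) (hcα : (1 + η) * c = α / 8) (hs0 : 0 < s) (hg0 : 0 ≤ g)
    (hS0 : 0 ≤ S) (hS1 : S ≤ s) (hε0 : 0 < ε) (hε1 : ε ≤ 1) (hm0 : 0 ≤ m) (hX : 1 ≤ X)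
    (hρ1 : ρ ≤ c * m) (hρ2 : c * m / 2 ≤ ρ) (hρ'0 : 0 ≤ ρ') (hρ' : ρ' ≤ c * m)
    (hup : ε * m ≤ g * X / 8) (hlow : α / 16 * X ≤ ε * m)
    (hbig : 2 * (1 + η) * (s + 1) ≤ α ^ 2 * (ε * m)) :
    α ^ 2 * c / 32 * X ≤ S + ε * (1 + α * ρ) ∧
      S + ε * (1 + α * (ρ' + (1 + α * m))) ≤ (s + 2 + g) * X ∧
      (1 + η) * (S + ε * (1 + α * ρ)) < S + ε * (1 + α * (ρ' + (1 + α * m))) := by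
  have hc8 : c ≤ 1 := by nlinarith
  have hεm0 : 0 ≤ ε * m := by positivity
  refine ⟨?_, ?_, ?_⟩
  · have hstep : α * (c / 2) * (ε * m) ≤ ε * (1 + α * ρ) := by
      calc α * (c / 2) * (ε * m) = ε * (0 + α * (c * m / 2)) := by ring
        _ ≤ _ := by gcongr; norm_num
    have : α * (c / 2) * (α / 16 * X) ≤ α * (c / 2) * (ε * m) := by gcongr
    linarith
  · have hA : α * (ρ' + (1 + α * m)) ≤ 1 * (1 * m + (1 + 1 * m)) := by
      gcongr
      exact hρ'.trans (by gcongr)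
    have hstep : ε * (1 + α * (ρ' + (1 + α * m))) ≤ 2 + 2 * (ε * m) := by
      calc _ ≤ ε * (1 + 1 * (1 * m + (1 + 1 * m))) := by gcongr
        _ = 2 * ε + 2 * (ε * m) := by ring
        _ ≤ _ := by linarith
    have : (s + 2) * 1 ≤ (s + 2) * X := by gcongr
    have : 0 ≤ g * X := by positivity
    linarith
  -- By the choice of `c`, the loser's variable part times `1 + η` is an eighth of the winner's term
  -- `α ^ 2 * (ε * m)`; by `hbig` the constant part is at most half of that term.
  · have hl : ε * (1 + α * ρ) ≤ 1 + α * c * (ε * m) := by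
      calc ε * (1 + α * ρ) ≤ ε * (1 + α * (c * m)) := by gcongr
        _ = ε + α * c * (ε * m) := by ring
        _ ≤ _ := by linarith
    have hu : α ^ 2 * (ε * m) ≤ ε * (1 + α * (ρ' + (1 + α * m))) := by
      calc α ^ 2 * (ε * m) = ε * (0 + α * (0 + (0 + α * m))) := by ring
        _ ≤ _ := by gcongr <;> norm_num
    have hη1 : (1 + η) * (S + ε * (1 + α * ρ))
        ≤ (1 + η) * (s + (1 + α * c * (ε * m))) := by gcongr
    have : (1 + η) * (s + (1 + α * c * (ε * m)))
        = (1 + η) * (s + 1) + α ^ 2 * (ε * m) / 8 := by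
      linear_combination (α * (ε * m)) * hcα
    have hpos : 0 < (1 + η) * (s + 1) := by positivity
    linarith

/-- The dilution along the paths. -/
theorem exists_dilution {α g x F L m : ℝ} {n : ℕ} (h0 : 0 < α) (h1 : α < 1)
    (hn : α ^ n ≤ 1 / x) (hx : 0 < x) (hF : 1 / x ≤ F) (hL : 1 ≤ L) (hg : 1 ≤ g)
    (hm1 : x / (16 * L) ≤ m) (hm2 : m ≤ x / (8 * L)) :
    ∃ h ≤ n, α / 16 * min (x / L) (g * (x * F)) ≤ α ^ (h + 1) * m ∧
      α ^ (h + 1) * m ≤ g * (x * F) / 8 := by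
  have hF0 : 0 < F := lt_of_lt_of_le (by positivity) hF
  have hL0 : 0 < L := by linarith
  have hm0 : 0 ≤ m := le_trans (by positivity) hm1
  have hFL : 1 / x ≤ g * (F * L) := by
    refine hF.trans ?_
    calc F = 1 * (F * 1) := by ring
      _ ≤ g * (F * L) := by gcongr
  obtain ⟨h, hhn, hε1, hε2⟩ := exists_pow_succ_le h0 h1 (hn.trans hFL)
  refine ⟨h, hhn, ?_, ?_⟩
  · calc α / 16 * min (x / L) (g * (x * F))
        = α * min 1 (g * (F * L)) * (x / (16 * L)) := by
          have : min (x / L) (g * (x * F)) = min 1 (g * (F * L)) * (x / L) := by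
            rw [min_mul_of_nonneg _ _ (by positivity : 0 ≤ x / L), one_mul]
            congr 1
            field_simp
          rw [this]
          field_simp
      _ ≤ α ^ (h + 1) * m := by gcongr
  · calc α ^ (h + 1) * m ≤ g * (F * L) * (x / (8 * L)) := by gcongr
      _ = g * (x * F) / 8 := by field_simp

/-- The parameters of the hard instances. -/
theorem exists_parameters {α η : ℝ} (h0 : 0 < α) (h1 : α < 1) (hη : 0 < η) :
    ∃ c₁ c₂ κ₀ : ℝ, 0 < c₁ ∧ 0 < c₂ ∧ 0 < κ₀ ∧ ∀ᶠ n : ℕ in atTop, ∀ F γ : ℝ,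
      1 / (n : ℝ) ≤ F → F ≤ 1 → 1 ≤ γ → ∃ h k d B m θ : ℕ,
        2 * (h + 2) + 2 * (k * (d + 1)) + B * m ≤ n ∧ 1 ≤ k ∧ 1 ≤ B ∧ (d + 1 : ℝ) ≤ 2 * γ ∧
        2 * θ * max B (2 * k) ≤ 2 * k * B ∧
        2 * κ₀ * min (1 / F) (min ((n : ℝ) ^ (2 / 3 : ℝ)) ((n : ℝ) ^ (1 / 2 : ℝ) * γ ^ (1 / 2 : ℝ)))
          ≤ θ ∧
        c₁ * (n * F) ≤ ∑ j ∈ Finset.range (h + 1), α ^ j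
          + α ^ (h + 1) * (1 + α * (k / (d + 1))) ∧
        ∑ j ∈ Finset.range (h + 1), α ^ j
          + α ^ (h + 1) * (1 + α * ((k - 1) / (d + 1) + (1 + α * m))) ≤ c₂ * (n * F) ∧
        (1 + η) * (∑ j ∈ Finset.range (h + 1), α ^ j
            + α ^ (h + 1) * (1 + α * (k / (d + 1))))
          < ∑ j ∈ Finset.range (h + 1), α ^ j
            + α ^ (h + 1) * (1 + α * ((k - 1) / (d + 1) + (1 + α * m))) := by
  have hα : 0 < 1 - α := by linarith
  obtain ⟨c, hc0, hcα, hc8⟩ : ∃ c : ℝ, 0 < c ∧ (1 + η) * c = α / 8 ∧ c ≤ 1 / 8 := by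
    refine ⟨α / (8 * (1 + η)), by positivity, by field_simp, ?_⟩
    rw [div_le_iff₀ (by positivity)]
    linarith
  obtain ⟨s, hs0, hs⟩ : ∃ s : ℝ, 0 < s ∧ s = (1 - α)⁻¹ := ⟨_, by positivity, rfl⟩
  -- The slack `g` lets the incoming mass dominate the constant part of the scores even when `n * F`
  -- is bounded.
  obtain ⟨g, hg1, hg2, hg3⟩ :
      ∃ g : ℝ, 32 * (1 + η) * (s + 1) / α ^ 3 ≤ g ∧ 16 / c ≤ g ∧ 1 ≤ g :=
    ⟨_, le_max_left _ _, (le_max_left _ _).trans (le_max_right _ _),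
      (le_max_right _ _).trans (le_max_right _ _)⟩
  rw [div_le_iff₀ (by positivity)] at hg1
  rw [div_le_iff₀' hc0] at hg2
  refine ⟨α ^ 2 * c / 32, s + 2 + g, c / 128, by positivity, by positivity, by positivity, ?_⟩
  filter_upwards [eventually_pow_div_le h0 h1, eventually_ge_atTop 16,
    eventually_ge_atTop ⌈g ^ 3⌉₊] with n hnpow hn16 hng F γ hF hF1 hγ
  have hn16' : (16 : ℝ) ≤ n := by exact_mod_cast hn16
  have hng' : g ^ 3 ≤ (n : ℝ) := (Nat.le_ceil _).trans (by exact_mod_cast hng)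
  obtain ⟨x, hx⟩ : ∃ x : ℝ, x = n := ⟨_, rfl⟩
  rw [← hx] at hn16' hng' hF hnpow ⊢
  have hx0 : 0 < x := by linarith
  have hF0 : 0 < F := lt_of_lt_of_le (by positivity) hF
  have hxF : 1 ≤ x * F := by rwa [div_le_iff₀' hx0] at hF
  obtain ⟨hL1, hLF, hL3, hL2⟩ := min_bound_facts (by linarith : 1 ≤ x) hF0 hF1 hγ
  generalize min (1 / F) (min (x ^ (2 / 3 : ℝ)) (x ^ (1 / 2 : ℝ) * γ ^ (1 / 2 : ℝ))) = L at *
  have hL0 : 0 < L := by linarith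
  -- From `L ^ 3 ≤ x ^ 2` follows `(x / L) ^ 3 ≥ x ≥ g ^ 3`.
  have hgxL : g ≤ x / L := by
    refine le_of_pow_le_pow_left₀ (n := 3) (by norm_num) (by positivity) (hng'.trans ?_)
    rw [div_pow, le_div_iff₀ (by positivity)]
    calc x * L ^ 3 ≤ x * x ^ 2 := by gcongr
      _ = x ^ 3 := by ring
  obtain ⟨k, d, B, m, hk1, hB2, hBL, hkL, hd, hm1, hm2, hkd1, hkd2, hkd, hBm⟩ :=
    exists_sizes (x := x) hL1 hL3 hc0 hc8 (hg2.trans (by gcongr))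
  obtain ⟨h, hhn, hlow, hup⟩ := exists_dilution h0 h1 hnpow hx0 hF hL1 hg3 hm1 hm2
  have hm0 : (0 : ℝ) ≤ m := Nat.cast_nonneg m
  have hk1' : (1 : ℝ) ≤ k := by exact_mod_cast hk1
  have hd0 : (0 : ℝ) < d + 1 := by positivity
  have hlow1 : α / 16 * (x * F) ≤ α ^ (h + 1) * m := by
    refine le_trans ?_ hlow
    gcongr
    refine le_min ?_ (le_mul_of_one_le_left (by positivity) hg3)
    rw [le_div_iff₀ hL0]
    calc x * F * L = x * (L * F) := by ring
      _ ≤ x * 1 := by gcongr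
      _ = x := mul_one x
  have hlow2 : 2 * (1 + η) * (s + 1) ≤ α ^ 2 * (α ^ (h + 1) * m) := by
    have hgm : α / 16 * g ≤ α ^ (h + 1) * m := by
      refine le_trans ?_ hlow
      gcongr
      exact le_min hgxL (le_mul_of_one_le_right (by linarith) hxF)
    calc 2 * (1 + η) * (s + 1) ≤ α ^ 2 * (α / 16 * g) := by linarith
      _ ≤ _ := by gcongr
  have hscores := score_bounds (ρ := (k : ℝ) / (d + 1)) (ρ' := ((k : ℝ) - 1) / (d + 1)) h0 h1 hη
    hc0 hcα hs0 (by linarith) (Finset.sum_nonneg fun j _ => by positivity)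
    ((geom_sum_le_inv h0 h1 (h + 1)).trans_eq hs.symm) (by positivity)
    (pow_le_one₀ h0.le h1.le) hm0 hxF hkd1 hkd2 (div_nonneg (by linarith) hd0.le)
    (le_trans (by gcongr; linarith) hkd1) hup hlow1 hlow2
  -- With minimum at least `2`, the floor in `θ` retains at least a quarter of it, whence `κ₀ = c /
  -- 128`.
  have hmin : 2 ≤ min (2 * k) B := le_min (by omega) hB2
  refine ⟨h, k, d, B, m, min (2 * k) B / 2, ?_, hk1, by omega, ?_, ?_, ?_, hscores⟩
  · have hh : (8 : ℝ) * h ≤ x := by rw [hx]; exact_mod_cast (by omega : 8 * h ≤ n)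
    have : (2 * (h + 2) + 2 * (k * (d + 1)) + B * m : ℝ) ≤ n := by linarith
    exact_mod_cast this
  · have : L ^ 2 / x ≤ γ := by rw [div_le_iff₀ hx0]; linarith
    linarith
  · calc 2 * (min (2 * k) B / 2) * max B (2 * k) ≤ min (2 * k) B * max B (2 * k) := by
          gcongr
          exact Nat.mul_div_le _ _
      _ = 2 * k * B := by rw [max_comm, min_mul_max]
  · have hθ : (min (2 * k) B : ℕ) ≤ 4 * (min (2 * k) B / 2) := by omega
    have hθ' : ((min (2 * k) B : ℕ) : ℝ) ≤ 4 * ((min (2 * k) B / 2 : ℕ) : ℝ) := by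
      exact_mod_cast hθ
    have hKL : c * L / 16 ≤ ((min (2 * k) B : ℕ) : ℝ) := by
      rw [Nat.cast_min]
      refine le_min (by push_cast; linarith) ?_
      nlinarith
    linarith

end PageRankLB

open Filter
open scoped ENNReal

namespace PageRankLB

/-! ### Relabelling of nodes -/

/-- The graph `G` with its nodes relabelled. -/
def relabel {V W : Type} (e : V ≃ W) (G : Digraph W) : Digraph V where
  Adj x y := G.Adj (e x) (e y)

theorem outdegree_relabel {V W : Type} (e : V ≃ W) (G : Digraph W) (x : V) :
    outdegree (relabel e G) x = outdegree G (e x) := by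
  rw [outdegree, outdegree, ← Set.ncard_image_of_injective _ e.injective]
  congr 1
  ext w
  simp only [relabel, Set.mem_image]
  constructor
  · rintro ⟨y, hy, rfl⟩
    exact hy
  · intro hw
    exact ⟨e.symm w, by simpa using hw, by simp⟩

/-- By uniqueness it is enough that the transported scores solve the PageRank equation. -/
theorem pageRank_relabel {V W : Type} [Fintype V] [Fintype W] {α : ℝ} (h0 : 0 < α) (h1 : α < 1)
    (e : V ≃ W) (G : Digraph W) (x : V) :
    pageRank α (relabel e G) x = pageRank α G (e x) := by
  refine (congrFun ((isPageRank_iff h0 h1 (relabel e G) fun x => pageRank α G (e x)).1 ?_) x).symm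
  have hM : ∀ x y, walkMatrix (relabel e G) x y = walkMatrix G (e x) (e y) := fun x y => by
    simp only [walkMatrix, Matrix.of_apply, outdegree_relabel, Fintype.card_congr e]
    rfl
  rw [IsPageRank]
  funext y
  rw [pageRank_apply h0 h1 G (e y)]
  simp only [Pi.add_apply, Pi.smul_apply, smul_eq_mul, Matrix.vecMul, dotProduct, hM,
    Fintype.card_congr e]
  rw [Equiv.sum_comp e fun w => pageRank α G w * walkMatrix G w (e y), add_comm]

/-! ### Queries on the hard instances -/

theorem ncard_distinguishing_le {V : Type} {h k d B m r : ℕ} (e : V ≃ Node h k d B m r)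
    (K : Set V) (Q : Query V) (hQ : Q.IsNatural K) :
    {sel | Q (relabel e (gadget none)) ≠ Q (relabel e (gadget (some sel)))}.ncard
      ≤ max B (2 * k) := by
  rcases hQ.2 with hQ | ⟨w, -, hQ⟩
  · have : {sel | Q (relabel e (gadget none)) ≠ Q (relabel e (gadget (some sel)))} = ∅ :=
      Set.eq_empty_of_forall_notMem fun sel hsel => hsel (hQ _ _)
    rw [this]
    simp
  · refine (Set.ncard_le_ncard ?_ (Set.toFinite _)).trans (ncard_affected_le (e w))
    intro sel hsel
    by_contra hn
    have hn' : ¬ ((∃ j, e w = .cell sel.1 sel.2.1 j) ∨ ∃ a, e w = .block sel.2.2 a) := hn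
    push Not at hn'
    exact hsel (hQ _ _ (fun x => gadget_adj_left hn'.1 hn'.2 (e x))
      fun x => gadget_adj_right hn'.1 hn'.2 (e x))

theorem stopped_add_stopped_le {V : Type} {u v : V} (huv : u ≠ v) (μ : PMF (Config V)) :
    μ (.stopped u) + μ (.stopped v) ≤ 1 := by
  rw [← expect_isStopped, ← expect_isStopped, ← PMF.expect_add]
  refine PMF.expect_le_one _ fun c => ?_
  cases c with
  | running h => simp [Config.isStopped]
  | stopped b =>
    simp only [Config.isStopped]
    split_ifs <;> simp_all

/-- Each side wins in half of the instances, so an answer law independent of the instance is right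
at most half the time. -/
theorem sum_stopped_le {V : Type} {k B : ℕ} (u : Bool → V) (hu : u false ≠ u true)
    (μ : PMF (Config V)) :
    2 * ∑ sel : Bool × Fin k × Fin B, μ (.stopped (u sel.1))
      ≤ (Fintype.card (Bool × Fin k × Fin B) : ℝ≥0∞) := by
  rw [Fintype.sum_prod_type]
  simp only [Finset.sum_const, Fintype.sum_bool, Finset.card_univ, nsmul_eq_mul,
    Fintype.card_prod, Fintype.card_bool, Fintype.card_fin, ← mul_add]
  push_cast
  calc _ = 2 * ((k : ℝ≥0∞) * B) * (μ (.stopped (u false)) + μ (.stopped (u true))) := by ring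
    _ ≤ 2 * ((k : ℝ≥0∞) * B) * 1 := by gcongr; exact stopped_add_stopped_le hu μ
    _ = _ := by ring

/-- On average over the hard instances, success requires queries. -/
theorem sum_successProb_le {V : Type} {h k d B m r : ℕ} (e : V ≃ Node h k d B m r)
    (A : RankingAlgorithm V) (θ : ℕ) (hθ : 2 * θ * max B (2 * k) ≤ 2 * k * B) :
    2 * θ * ∑ sel : Bool × Fin k × Fin B, A.successProb (relabel e (gadget (some sel)))
        (e.symm (.path sel.1 0)) (e.symm (.path (!sel.1) 0))
      ≤ θ * (Fintype.card (Bool × Fin k × Fin B) : ℝ≥0∞)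
        + 4 * ∑ sel : Bool × Fin k × Fin B, A.meanQueries (relabel e (gadget (some sel)))
          (e.symm (.path sel.1 0)) (e.symm (.path (!sel.1) 0)) := by
  set u : Bool → V := fun s => e.symm (.path s 0) with hu
  set H : Bool × Fin k × Fin B → Digraph V := fun sel => relabel e (gadget (some sel)) with hH
  have hne : u false ≠ u true := by simp [hu]
  have key : ∀ input, 2 * θ * ∑ sel, A.probAnswer (H sel) input (u sel.1)
      ≤ θ * (Fintype.card (Bool × Fin k × Fin B) : ℝ≥0∞)
        + 4 * ∑ sel, A.expectedQueries (H sel) input := fun input =>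
    A.sum_probAnswer_le input (relabel e (gadget none)) H (max B (2 * k))
      (ncard_distinguishing_le e) θ (by simpa [mul_assoc] using hθ) (fun sel => u sel.1)
      (sum_stopped_le u hne)
  -- Random order is regrouped into two fixed inputs, neither of which reveals the winner.
  have hsucc : ∑ sel, A.successProb (H sel) (u sel.1) (u !sel.1)
      = (∑ sel, A.probAnswer (H sel) (u true, u false) (u sel.1)
        + ∑ sel, A.probAnswer (H sel) (u false, u true) (u sel.1)) / 2 := by
    rw [← Finset.sum_add_distrib, div_eq_mul_inv, Finset.sum_mul]
    refine Finset.sum_congr rfl fun sel _ => ?_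
    rw [RankingAlgorithm.successProb, div_eq_mul_inv]
    rcases sel with ⟨_ | _, p, q⟩
    · rw [add_comm]; rfl
    · rfl
  have hmean : ∑ sel, A.meanQueries (H sel) (u sel.1) (u !sel.1)
      = (∑ sel, A.expectedQueries (H sel) (u true, u false)
        + ∑ sel, A.expectedQueries (H sel) (u false, u true)) / 2 := by
    rw [← Finset.sum_add_distrib, div_eq_mul_inv, Finset.sum_mul]
    refine Finset.sum_congr rfl fun sel _ => ?_
    rw [RankingAlgorithm.meanQueries, div_eq_mul_inv]
    rcases sel with ⟨_ | _, p, q⟩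
    · rw [add_comm]; rfl
    · rfl
  rw [hsucc, hmean]
  have h1 := key (u true, u false)
  have h2 := key (u false, u true)
  generalize ∑ sel, A.probAnswer (H sel) (u true, u false) (u sel.1) = p1 at *
  generalize ∑ sel, A.probAnswer (H sel) (u false, u true) (u sel.1) = p2 at *
  generalize ∑ sel, A.expectedQueries (H sel) (u true, u false) = e1 at *
  generalize ∑ sel, A.expectedQueries (H sel) (u false, u true) = e2 at *
  generalize (Fintype.card (Bool × Fin k × Fin B) : ℝ≥0∞) = N at *
  calc 2 * θ * ((p1 + p2) / 2) = (2 * θ * p1 + 2 * θ * p2) / 2 := by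
        simp only [div_eq_mul_inv]; ring
    _ ≤ ((θ * N + 4 * e1) + (θ * N + 4 * e2)) / 2 := by gcongr
    _ = θ * N * (2 * 2⁻¹) + 4 * ((e1 + e2) / 2) := by
        simp only [div_eq_mul_inv]; ring
    _ = _ := by rw [ENNReal.mul_inv_cancel (by norm_num) (by norm_num), mul_one]

/-- One of the hard instances is hard for every advantage `δ`. -/
theorem exists_hard_instance {V : Type} {h k d B m r : ℕ} (e : V ≃ Node h k d B m r)
    (hk : 1 ≤ k) (hB : 1 ≤ B) (A : RankingAlgorithm V) (θ : ℕ)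
    (hθ : 2 * θ * max B (2 * k) ≤ 2 * k * B) {b : ℝ} (hb0 : 0 ≤ b) (hb : 2 * b ≤ θ) :
    ∃ sel : Bool × Fin k × Fin B, ∀ δ : ℝ, 0 < δ →
      ENNReal.ofReal (1 / 2 + δ) ≤ A.successProb (relabel e (gadget (some sel)))
        (e.symm (.path sel.1 0)) (e.symm (.path (!sel.1) 0)) →
      ENNReal.ofReal (δ * b) ≤ A.meanQueries (relabel e (gadget (some sel)))
        (e.symm (.path sel.1 0)) (e.symm (.path (!sel.1) 0)) := by
  by_contra! hcon
  -- Each instance may fail with its own `δ`; linearity in `δ` lets these failures be summed.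
  choose δ hδ hs hq using hcon
  have hav := sum_successProb_le e A θ hθ
  have hne : (Finset.univ : Finset (Bool × Fin k × Fin B)).Nonempty :=
    ⟨(true, ⟨0, hk⟩, ⟨0, hB⟩), Finset.mem_univ _⟩
  have hδsum : 0 < ∑ sel, δ sel := Finset.sum_pos (fun sel _ => hδ sel) hne
  set N := Fintype.card (Bool × Fin k × Fin B) with hN
  have hlow : ENNReal.ofReal (2 * θ * (N / 2 + ∑ sel, δ sel))
      ≤ 2 * θ * ∑ sel : Bool × Fin k × Fin B, A.successProb (relabel e (gadget (some sel)))
        (e.symm (.path sel.1 0)) (e.symm (.path (!sel.1) 0)) := by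
    have : (N / 2 + ∑ sel, δ sel : ℝ) = ∑ sel, (1 / 2 + δ sel) := by
      rw [Finset.sum_add_distrib]
      simp [hN]
      ring
    rw [this, ENNReal.ofReal_mul (by positivity), ENNReal.ofReal_sum_of_nonneg
      (fun sel _ => by linarith [hδ sel]), ENNReal.ofReal_mul (by norm_num)]
    simp only [ENNReal.ofReal_ofNat, ENNReal.ofReal_natCast]
    gcongr with sel
    exact hs sel
  have hup : ∑ sel : Bool × Fin k × Fin B, A.meanQueries (relabel e (gadget (some sel)))
        (e.symm (.path sel.1 0)) (e.symm (.path (!sel.1) 0))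
      < ENNReal.ofReal ((∑ sel, δ sel) * b) := by
    rw [Finset.sum_mul, ENNReal.ofReal_sum_of_nonneg fun sel _ => mul_nonneg (hδ sel).le hb0]
    exact ENNReal.sum_lt_sum_of_nonempty hne fun sel _ => hq sel
  have hfin : ENNReal.ofReal (2 * θ * (N / 2 + ∑ sel, δ sel))
      < ENNReal.ofReal (θ * N + 4 * ((∑ sel, δ sel) * b)) := by
    refine (hlow.trans hav).trans_lt ?_
    rw [ENNReal.ofReal_add (by positivity) (by positivity), ENNReal.ofReal_mul (by positivity),
      ENNReal.ofReal_mul (p := 4) (by norm_num)]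
    simp only [ENNReal.ofReal_ofNat, ENNReal.ofReal_natCast]
    refine ENNReal.add_lt_add_left (by finiteness) ?_
    exact (ENNReal.mul_lt_mul_iff_right (by norm_num) (by norm_num)).2 hup
  have := (ENNReal.ofReal_lt_ofReal_iff_of_nonneg (by positivity)).1 hfin
  -- What remains is `θ * ∑ δ < 2 * b * ∑ δ`, against `2 * b ≤ θ`.
  nlinarith

end PageRankLB

/-! ### Assembling the lower bound. -/

open PageRankLB

theorem mainTheorem3 (α η : ℝ) (hα0 : 0 < α) (hα1 : α < 1) (hη : 0 < η) :
    ∃ (C c₁ c₂ : ℝ) (κ : ℝ → ℝ), 0 < C ∧ 0 < c₁ ∧ 0 < c₂ ∧ (∀ δ, 0 < δ → 0 < κ δ) ∧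
      ∀ f γ : ℕ → ℝ,
        (∀ n : ℕ, 1 ≤ n → 1 / (n : ℝ) ≤ f n ∧ f n ≤ 1 ∧ 1 ≤ γ n) →
        ∀ A : (n : ℕ) → PageRankLB.RankingAlgorithm (Fin n),
        ∀ N : ℕ, ∃ n : ℕ, N ≤ n ∧ 1 ≤ n ∧
          ∃ (G : Digraph (Fin n)) (u v : Fin n),
            (∀ w, (PageRankLB.outdegree G w : ℝ) ≤ C * γ n) ∧
            (c₁ * f n ≤ PageRankLB.pageRank α G u ∧ PageRankLB.pageRank α G u ≤ c₂ * f n) ∧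
            (c₁ * f n ≤ PageRankLB.pageRank α G v ∧ PageRankLB.pageRank α G v ≤ c₂ * f n) ∧
            (1 + η) * PageRankLB.pageRank α G v < PageRankLB.pageRank α G u ∧
            ∀ δ : ℝ, 0 < δ →
              ENNReal.ofReal (1 / 2 + δ) ≤ (A n).successProb G u v →
              ENNReal.ofReal (κ δ * min (1 / f n)
                  (min ((n : ℝ) ^ (2 / 3 : ℝ)) ((n : ℝ) ^ (1 / 2 : ℝ) * γ n ^ (1 / 2 : ℝ))))
                ≤ (A n).meanQueries G u v := by
  obtain ⟨c₁, c₂, κ₀, hc₁, hc₂, hκ₀, hev⟩ := exists_parameters hα0 hα1 hη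
  refine ⟨2, c₁, c₂, fun δ => δ * κ₀, by norm_num, hc₁, hc₂, fun δ hδ => by positivity, ?_⟩
  intro f γ hfγ A N
  obtain ⟨n, hn, hNn, hn1⟩ :=
    (hev.and ((eventually_ge_atTop N).and (eventually_ge_atTop 1))).exists
  obtain ⟨hf, hf1, hγ⟩ := hfγ n hn1
  obtain ⟨h, k, d, B, m, θ, hcard, hk, hB, hd, hθ, hb, hlow, hup, hratio⟩ :=
    hn (f n) (γ n) hf hf1 hγ
  have hn0 : (0 : ℝ) < n := by exact_mod_cast hn1
  have hf0 : 0 < f n := lt_of_lt_of_le (by positivity) hf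
  -- Isolated filler nodes with self-loops bring the number of nodes to exactly `n`.
  obtain ⟨r, hr⟩ := Nat.exists_eq_add_of_le hcard
  have hcardNode : Fintype.card (Node h k d B m r) = n := by rw [Node.card_eq, hr]
  have e : Fin n ≃ Node h k d B m r :=
    Fintype.equivOfCardEq (by rw [Fintype.card_fin, hcardNode])
  obtain ⟨⟨t, p, q⟩, hsel⟩ := exists_hard_instance e hk hB (A n) θ hθ
    (b := κ₀ * min (1 / f n)
      (min ((n : ℝ) ^ (2 / 3 : ℝ)) ((n : ℝ) ^ (1 / 2 : ℝ) * γ n ^ (1 / 2 : ℝ))))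
    (by positivity) (by linarith)
  have hu := card_mul_pageRank_winner (h := h) (d := d) (m := m) (r := r) hα0 hα1 t p q
  have hv := card_mul_pageRank_loser (h := h) (d := d) (m := m) (r := r) hα0 hα1 t p q
  rw [← hu, ← hv, hcardNode] at hratio
  rw [← hu, hcardNode] at hup
  rw [← hv, hcardNode] at hlow
  refine ⟨n, hNn, hn1, relabel e (gadget (some (t, p, q))), e.symm (.path t 0),
    e.symm (.path (!t) 0), fun w => ?_, ?_⟩
  · rw [outdegree_relabel]
    refine le_trans ?_ hd
    rcases outdegree_gadget (some (t, p, q)) (e w) with ho | ho <;> rw [ho] <;> push_cast <;>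
      linarith [(Nat.cast_nonneg d : (0 : ℝ) ≤ d)]
  rw [pageRank_relabel hα0 hα1, pageRank_relabel hα0 hα1, Equiv.apply_symm_apply,
    Equiv.apply_symm_apply]
  generalize pageRank α (gadget (some (t, p, q)) : Digraph (Node h k d B m r)) (.path t 0) = U at *
  generalize pageRank α (gadget (some (t, p, q)) : Digraph (Node h k d B m r)) (.path (!t) 0) = W
    at *
  have hW : c₁ * f n ≤ W := by
    refine le_of_mul_le_mul_left (le_of_eq_of_le ?_ hlow) hn0
    ring
  have hU : U ≤ c₂ * f n := by
    refine le_of_mul_le_mul_left (hup.trans_eq ?_) hn0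
    ring
  have hUW : (1 + η) * W < U := by
    refine lt_of_mul_lt_mul_left (lt_of_eq_of_lt ?_ hratio) hn0.le
    ring
  have hWU : W ≤ U := by nlinarith [mul_pos hc₁ hf0]
  refine ⟨⟨hW.trans hWU, hU⟩, ⟨hW, hWU.trans hU⟩, hUW, fun δ hδ hs => ?_⟩
  rw [mul_assoc]
  exact hsel δ hδ hs
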